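/- Let $q\in\mathbb{C}\setminus\{0\}$ not be a root of unity and let $M>1$, $N\ge 1$ be integers with $M\neq N$. Put $l_i=1$ for $1\le i\le M$, $l_i=-1$ for $M<i\le M+N$, $q_i=q^{l_i}$, $q_0=q$, and $(\epsilon_i,\epsilon_j)=l_i\delta_{ij}$, $c_{i,j}=(\epsilon_i-\epsilon_{i+1},\epsilon_j-\epsilon_{j+1})$ for $1\le i,j\le M+N-1$; put also $c_{0,0}=0$ and $c_{0,i}=c_{i,0}=-\delta_{i,1}+\delta_{i,M+N-1}$. In a superalgebra write $[a,b]_u=ab-(-1)^{|a||b|}u\,ba$ for homogeneous $a,b$, and $[a,b]=[a,b]_1$. Let $U_q(\mathfrak{gl}(M,N))$ be the complex superalgebra with generators $t_i^{\pm1}$ ($1\le i\le M+N$) and $e_j^{\pm}$ ($1\le j\le M+N-1$), where $e_M^\pm$ are odd and all other generators even, and relations $$t_it_i^{-1}=t_i^{-1}t_i=1,\quad t_it_{i'}=t_{i'}t_i,\quad t_ie_j^{\pm}t_i^{-1}=q^{\pm l_i(\epsilon_i,\epsilon_j-\epsilon_{j+1})}e_j^\pm,$$ $$[e_j^+,e_k^-]=\delta_{j,k}\frac{t_j^{l_j}t_{j+1}^{-l_{j+1}}-t_j^{-l_j}t_{j+1}^{l_{j+1}}}{q_j-q_j^{-1}},\qquad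 [e_j^\pm,e_k^\pm]=0\ \text{ if } c_{j,k}=0,$$ $$[e_j^\pm,[e_j^\pm,e_k^\pm]_{q^{-1}}]_q=0\ \text{ if } c_{j,k}=\pm1,\ j\ne M,\qquad [[[e_{M-1}^\pm,e_M^\pm]_q,e_{M+1}^\pm]_{q^{-1}},e_M^\pm]=0\ \text{ if } M,N>1.$$ Let $U_q'(\widehat{\mathfrak{sl}(M,N)})$ be the complex superalgebra with generators $E_i^\pm,K_i^{\pm1}$ ($0\le i\le M+N-1$), where $E_0^\pm,E_M^\pm$ are odd and all other generators even, and relations $$K_iK_i^{-1}=K_i^{-1}K_i=1,\quad K_iK_j=K_jK_i,\quad K_iE_j^\pm K_i^{-1}=q^{\pm c_{i,j}}E_j^\pm,\quad [E_i^+,E_j^-]=\delta_{i,j}\frac{K_i-K_i^{-1}}{q_i-q_i^{-1}},$$ $$[E_i^\pm,E_j^\pm]=0\ \text{ if } c_{i,j}=0,\qquad [E_i^\pm,[E_i^\pm,E_j^\pm]_{q^{-1}}]_q=0\ \text{ if } c_{i,j}=\pm1,\ i\ne 0,M,$$ $$[[[E_{M-1}^\pm,E_M^\pm]_{q^{-1}},E_{M+1}^\pm]_q,E_M^\pm]=0=[[[E_1^\pm,E_0^\pm]_{q^{-1}},E_{M+N-1}^\pm]_q,E_0^\pm]\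 \text{ if } M+N>3$$ (indices modulo $M+N$, so $E_{M+1}^\pm=E_0^\pm$ when $N=1$), and, if $(M,N)=(2,1)$, $$[E_0^\pm,[E_2^\pm,[E_0^\pm,[E_2^\pm,E_1^\pm]_q]]]_{q^{-1}}=[E_2^\pm,[E_0^\pm,[E_2^\pm,[E_0^\pm,E_1^\pm]_q]]]_{q^{-1}}.$$ Then there exists a morphism of superalgebras $\mathrm{ev}:U_q'(\widehat{\mathfrak{sl}(M,N)})\to U_q(\mathfrak{gl}(M,N))$ such that $\mathrm{ev}(K_j)=t_j^{l_j}t_{j+1}^{-l_{j+1}}$ and $\mathrm{ev}(E_j^\pm)=e_j^\pm$ for $1\le j\le M+N-1$, $\mathrm{ev}(K_0)=t_1^{-1}t_{M+N}^{-1}$, and $$\mathrm{ev}(E_0^+)=-(-q)^{N-M}\,[\cdots[[e_1^-,e_2^-]_{q_2},e_3^-]_{q_3},\cdots,e_{M+N-1}^-]_{q_{M+N-1}}\,t_1t_{M+N}^{-1},$$ $$\mathrm{ev}(E_0^-)=t_1^{-1}t_{M+N}\,[\cdots[[e_1^+,e_2^+]_{q_2},e_3^+]_{q_3},\cdots,e_{M+N-1}^+]_{q_{M+N-1}}.$$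 -/

import Mathlib

noncomputable section

namespace QSuper

/-! ### Superalgebras presented by generators, degrees and relations -/

/-- The part of degree `i` of the free algebra on `X`, when the generator `x` has degree `p x`:
the span of the words of total degree `i`. -/
def freePart {X : Type*} (p : X → ZMod 2) (i : ZMod 2) : Submodule ℂ (FreeAlgebra ℂ X) :=
  Submodule.span ℂ {w | ∃ L : List X, (L.map p).sum = i ∧ w = (L.map (FreeAlgebra.ι ℂ)).prod}

/-- The part of degree `i` of the algebra with generators `X` and relations `r`: the image of the
part of degree `i` of the free algebra. -/
def part {X : Type*} (p : X → ZMod 2) (r : FreeAlgebra ℂ X → FreeAlgebra ℂ X → Prop)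
    (i : ZMod 2) : Submodule ℂ (RingQuot r) :=
  (freePart p i).map (RingQuot.mkAlgHom ℂ r).toLinearMap

/-- All relations are homogeneous. -/
def HomogRel {X : Type*} (p : X → ZMod 2) (r : FreeAlgebra ℂ X → FreeAlgebra ℂ X → Prop) : Prop :=
  ∀ a b, r a b → ∃ i, a ∈ freePart p i ∧ b ∈ freePart p i

theorem freePart_one {X : Type*} (p : X → ZMod 2) : (1 : FreeAlgebra ℂ X) ∈ freePart p 0 :=
  Submodule.subset_span ⟨[], by simp, by simp⟩

theorem freePart_ι {X : Type*} (p : X → ZMod 2) (x : X) :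
    FreeAlgebra.ι ℂ x ∈ freePart p (p x) :=
  Submodule.subset_span ⟨[x], by simp, by simp⟩

theorem freePart_mul {X : Type*} (p : X → ZMod 2) {i j : ZMod 2} {a b : FreeAlgebra ℂ X}
    (ha : a ∈ freePart p i) (hb : b ∈ freePart p j) : a * b ∈ freePart p (i + j) := by
  have h := Submodule.mul_mem_mul ha hb
  rw [freePart, freePart, Submodule.span_mul_span] at h
  refine Submodule.span_mono ?_ h
  rintro _ ⟨_, ⟨L, rfl, rfl⟩, _, ⟨L', rfl, rfl⟩, rfl⟩
  exact ⟨L ++ L', by simp, by simp⟩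

theorem mk_mem_part {X : Type*} (p : X → ZMod 2) (r : FreeAlgebra ℂ X → FreeAlgebra ℂ X → Prop)
    {i : ZMod 2} {a : FreeAlgebra ℂ X} (ha : a ∈ freePart p i) :
    RingQuot.mkAlgHom ℂ r a ∈ part p r i := ⟨a, ha, rfl⟩

instance part_gradedMonoid {X : Type*} (p : X → ZMod 2)
    (r : FreeAlgebra ℂ X → FreeAlgebra ℂ X → Prop) : SetLike.GradedMonoid (part p r) where
  one_mem := ⟨1, freePart_one p, by simp⟩
  mul_mem := by
    rintro i j _ _ ⟨a, ha, rfl⟩ ⟨b, hb, rfl⟩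
    exact ⟨a * b, freePart_mul p ha hb, by simp⟩

/-- The map from the free algebra that sends a generator to itself, placed in its degree. -/
def toSum {X : Type*} (p : X → ZMod 2) (r : FreeAlgebra ℂ X → FreeAlgebra ℂ X → Prop) :
    FreeAlgebra ℂ X →ₐ[ℂ] DirectSum (ZMod 2) (fun i => part p r i) :=
  FreeAlgebra.lift ℂ fun x => DirectSum.of (fun i => part p r i) (p x)
    ⟨RingQuot.mkAlgHom ℂ r (FreeAlgebra.ι ℂ x), mk_mem_part p r (freePart_ι p x)⟩

theorem toSum_apply {X : Type*} (p : X → ZMod 2) (r : FreeAlgebra ℂ X → FreeAlgebra ℂ X → Prop)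
    {i : ZMod 2} {a : FreeAlgebra ℂ X} (ha : a ∈ freePart p i) :
    toSum p r a = DirectSum.of (fun i => part p r i) i ⟨RingQuot.mkAlgHom ℂ r a, mk_mem_part p r ha⟩ := by
  have word : ∀ L : List X, ∀ h, toSum p r (L.map (FreeAlgebra.ι ℂ)).prod =
      DirectSum.of (fun i => part p r i) (L.map p).sum
        ⟨RingQuot.mkAlgHom ℂ r (L.map (FreeAlgebra.ι ℂ)).prod, h⟩ := by
    intro L
    induction L with
    | nil =>
      intro h
      simp only [List.map_nil, List.prod_nil, map_one, DirectSum.one_def]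
      exact DirectSum.of_eq_of_gradedMonoid_eq (Sigma.subtype_ext rfl rfl)
    | cons x L ih =>
      intro h
      have hL : (L.map (FreeAlgebra.ι ℂ)).prod ∈ freePart p (L.map p).sum :=
        Submodule.subset_span ⟨L, rfl, rfl⟩
      simp only [List.map_cons, List.prod_cons, map_mul]
      rw [ih (mk_mem_part p r hL)]
      simp only [toSum, FreeAlgebra.lift_ι_apply]
      rw [DirectSum.of_mul_of]
      exact DirectSum.of_eq_of_gradedMonoid_eq (Sigma.subtype_ext rfl rfl)
  induction ha using Submodule.span_induction with
  | mem x hx =>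
    obtain ⟨L, rfl, rfl⟩ := hx
    exact word L _
  | zero =>
    rw [map_zero]
    refine (map_zero (DirectSum.of (fun i => part p r i) i)).symm.trans (congrArg _ ?_)
    exact Subtype.ext (by simp)
  | add x y hx hy h1 h2 =>
    rw [map_add, h1, h2, ← map_add]
    exact congrArg _ (Subtype.ext (by simp))
  | smul c x hx h1 =>
    rw [map_smul, h1]
    refine ((DirectSum.lof ℂ (ZMod 2) (fun i => part p r i) i).map_smul c _).symm.trans
      (congrArg _ ?_)
    exact Subtype.ext (by simp)

/-- The superalgebra structure of an algebra given by generators, degrees and homogeneous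
relations. -/
@[reducible] def gradedAlgebra {X : Type*} (p : X → ZMod 2)
    (r : FreeAlgebra ℂ X → FreeAlgebra ℂ X → Prop) (h : HomogRel p r) :
    GradedAlgebra (part p r) :=
  GradedAlgebra.ofAlgHom (part p r)
    (RingQuot.liftAlgHom ℂ ⟨toSum p r, by
      intro a b hab
      obtain ⟨i, ha, hb⟩ := h a b hab
      rw [toSum_apply p r ha, toSum_apply p r hb]
      exact congrArg _ (Subtype.ext (RingQuot.mkAlgHom_rel ℂ hab))⟩)
    (by
      ext x
      simp [toSum])
    (by
      rintro i ⟨_, a, ha, rfl⟩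
      simpa using toSum_apply p r ha)

/-- An element together with a degree. -/
structure HomElt (A : Type*) where
  deg : ZMod 2
  val : A

/-- The image under an algebra morphism, with the same degree. -/
def HomElt.map {A B : Type*} [Ring A] [Algebra ℂ A] [Ring B] [Algebra ℂ B] (f : A →ₐ[ℂ] B)
    (x : HomElt A) : HomElt B := ⟨x.deg, f x.val⟩

/-- The super-bracket `[x, y]_u = x y - (-1)^{|x||y|} u y x`, of degree `|x| + |y|`. -/
def sbr {A : Type*} [Ring A] [Algebra ℂ A] (u : ℂ) (x y : HomElt A) : HomElt A :=
  ⟨x.deg + y.deg,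
    x.val * y.val - ((-1 : ℂ) ^ (x.deg.val * y.deg.val) * u) • (y.val * x.val)⟩

/-- `x` lies in the part of the free algebra given by its degree. -/
def IsHomog {X : Type*} (p : X → ZMod 2) (x : HomElt (FreeAlgebra ℂ X)) : Prop :=
  x.val ∈ freePart p x.deg

theorem IsHomog.sbr {X : Type*} {p : X → ZMod 2} {x y : HomElt (FreeAlgebra ℂ X)} (u : ℂ)
    (hx : IsHomog p x) (hy : IsHomog p y) : IsHomog p (sbr u x y) := by
  refine Submodule.sub_mem _ (freePart_mul p hx hy) (Submodule.smul_mem _ _ ?_)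
  have := freePart_mul p hy hx
  rwa [add_comm] at this

/-! ### Cartan data. Indices are natural numbers, numbered from `1` as in `𝔤𝔩(M, N)`,
and the affine node is `0`. -/

/-- The sign `l_i` (`1` for `i ≤ M`, `-1` for `i > M`). -/
def l (M i : ℕ) : ℤˣ := if i ≤ M then 1 else -1

/-- `q_i = q ^ l_i`; in particular `q_0 = q`. -/
def qi (q : ℂ) (M i : ℕ) : ℂ := q ^ (l M i : ℤ)

/-- The bilinear form `(ε_i, ε_j) = l_i δ_{ij}`. -/
def epsForm (M i j : ℕ) : ℤ := if i = j then (l M i : ℤ) else 0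

/-- `c_{j,k} = (ε_j - ε_{j+1}, ε_k - ε_{k+1})`. -/
def cartan (M j k : ℕ) : ℤ :=
  epsForm M j k - epsForm M j (k + 1) - epsForm M (j + 1) k + epsForm M (j + 1) (k + 1)

/-- `- δ_{i,1} + δ_{i,M+N-1}`. -/
def cartanZero (M N i : ℕ) : ℤ :=
  -(if i = 1 then 1 else 0) + (if i = M + N - 1 then 1 else 0)

/-- The affine Cartan matrix `(c_{i,j})`, `0 ≤ i, j ≤ M + N - 1`. -/
def affCartan (M N i j : ℕ) : ℤ :=
  if i = 0 then (if j = 0 then 0 else cartanZero M N j)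
  else if j = 0 then cartanZero M N i
  else cartan M i j

/-! ### The quantum superalgebra `U_q(𝔤𝔩(M, N))` -/

/-- Generators: `t ε i` is `t_i^{ε}` for `1 ≤ i ≤ M + N`, and `e ε j` is `e_j^{ε}` for
`1 ≤ j ≤ M + N - 1`, where `ε = ±1`. -/
inductive GlGen (M N : ℕ) : Type
  | t (ε : ℤˣ) (i : ℕ) (h : 1 ≤ i ∧ i ≤ M + N)
  | e (ε : ℤˣ) (j : ℕ) (h : 1 ≤ j ∧ j < M + N)

/-- Degrees of the generators. -/
def GlGen.deg {M N : ℕ} : GlGen M N → ZMod 2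
  | .t _ _ _ => 0
  | .e _ j _ => if j = M then 1 else 0

/-- `t_i^{ε}` in the free algebra (`0` outside the range of indices, which is never used). -/
def freeT (M N : ℕ) (ε : ℤˣ) (i : ℕ) : FreeAlgebra ℂ (GlGen M N) :=
  if h : 1 ≤ i ∧ i ≤ M + N then FreeAlgebra.ι ℂ (.t ε i h) else 0

/-- `e_j^{ε}` in the free algebra (`0` outside the range of indices, which is never used). -/
def freee (M N : ℕ) (ε : ℤˣ) (j : ℕ) : HomElt (FreeAlgebra ℂ (GlGen M N)) :=
  ⟨if j = M then 1 else 0,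
    if h : 1 ≤ j ∧ j < M + N then FreeAlgebra.ι ℂ (.e ε j h) else 0⟩

/-- The defining relations of `U_q(𝔤𝔩(M, N))`. -/
inductive GlRel (q : ℂ) (M N : ℕ) :
    FreeAlgebra ℂ (GlGen M N) → FreeAlgebra ℂ (GlGen M N) → Prop
  | t_inv (ε : ℤˣ) (i : ℕ) (hi : 1 ≤ i ∧ i ≤ M + N) :
      GlRel q M N (freeT M N ε i * freeT M N (-ε) i) 1
  | t_comm (i i' : ℕ) (hi : 1 ≤ i ∧ i ≤ M + N) (hi' : 1 ≤ i' ∧ i' ≤ M + N) :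
      GlRel q M N (freeT M N 1 i * freeT M N 1 i') (freeT M N 1 i' * freeT M N 1 i)
  | t_e (ε : ℤˣ) (i j : ℕ) (hi : 1 ≤ i ∧ i ≤ M + N) (hj : 1 ≤ j ∧ j < M + N) :
      GlRel q M N (freeT M N 1 i * (freee M N ε j).val * freeT M N (-1) i)
        (q ^ ((ε : ℤ) * ((l M i : ℤ) * (epsForm M i j - epsForm M i (j + 1)))) •
          (freee M N ε j).val)
  | e_cross_same (j : ℕ) (hj : 1 ≤ j ∧ j < M + N) :
      GlRel q M N (sbr 1 (freee M N 1 j) (freee M N (-1) j)).val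
        ((qi q M j - (qi q M j)⁻¹)⁻¹ •
          (freeT M N (l M j) j * freeT M N (-l M (j + 1)) (j + 1)
            - freeT M N (-l M j) j * freeT M N (l M (j + 1)) (j + 1)))
  | e_cross (j k : ℕ) (hj : 1 ≤ j ∧ j < M + N) (hk : 1 ≤ k ∧ k < M + N) (hjk : j ≠ k) :
      GlRel q M N (sbr 1 (freee M N 1 j) (freee M N (-1) k)).val 0
  | e_comm (ε : ℤˣ) (j k : ℕ) (hj : 1 ≤ j ∧ j < M + N) (hk : 1 ≤ k ∧ k < M + N)
      (hc : cartan M j k = 0) :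
      GlRel q M N (sbr 1 (freee M N ε j) (freee M N ε k)).val 0
  | serre (ε : ℤˣ) (j k : ℕ) (hj : 1 ≤ j ∧ j < M + N) (hk : 1 ≤ k ∧ k < M + N)
      (hc : cartan M j k = 1 ∨ cartan M j k = -1) (hM : j ≠ M) :
      GlRel q M N
        (sbr q (freee M N ε j) (sbr q⁻¹ (freee M N ε j) (freee M N ε k))).val 0
  | quartic (ε : ℤˣ) (hM : 1 < M) (hN : 1 < N) :
      GlRel q M N
        (sbr 1 (sbr q⁻¹ (sbr q (freee M N ε (M - 1)) (freee M N ε M))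
          (freee M N ε (M + 1))) (freee M N ε M)).val 0

/-- The algebra underlying `U_q(𝔤𝔩(M, N))`. -/
abbrev UGl (q : ℂ) (M N : ℕ) : Type := RingQuot (GlRel q M N)

/-- The `ℤ/2`-grading of `U_q(𝔤𝔩(M, N))`. -/
abbrev glGrading (q : ℂ) (M N : ℕ) : ZMod 2 → Submodule ℂ (UGl q M N) :=
  part GlGen.deg (GlRel q M N)

/-- `t_i^{ε}` in `U_q(𝔤𝔩(M, N))`. -/
def t (q : ℂ) (M N : ℕ) (ε : ℤˣ) (i : ℕ) : UGl q M N :=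
  RingQuot.mkAlgHom ℂ (GlRel q M N) (freeT M N ε i)

/-- `e_j^{ε}` in `U_q(𝔤𝔩(M, N))`, with its degree. -/
def e (q : ℂ) (M N : ℕ) (ε : ℤˣ) (j : ℕ) : HomElt (UGl q M N) :=
  (freee M N ε j).map (RingQuot.mkAlgHom ℂ (GlRel q M N))

/-- `eBracket q M N ε k = [⋯[[e_1^ε, e_2^ε]_{q_2}, e_3^ε]_{q_3}, ⋯, e_{k+1}^ε]_{q_{k+1}}`. -/
def eBracket (q : ℂ) (M N : ℕ) (ε : ℤˣ) : ℕ → HomElt (UGl q M N)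
  | 0 => e q M N ε 1
  | k + 1 => sbr (qi q M (k + 2)) (eBracket q M N ε k) (e q M N ε (k + 2))

/-! ### The quantum affine superalgebra `U_q'(𝔰𝔩(M, N)^)` in its Chevalley presentation -/

/-- Generators: `K ε i` is `K_i^{ε}` and `E ε i` is `E_i^{ε}` for `0 ≤ i ≤ M + N - 1`,
where `ε = ±1`. -/
inductive AffGen (M N : ℕ) : Type
  | K (ε : ℤˣ) (i : ℕ) (h : i < M + N)
  | E (ε : ℤˣ) (i : ℕ) (h : i < M + N)

/-- Degrees of the generators. -/
def AffGen.deg {M N : ℕ} : AffGen M N → ZMod 2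
  | .K _ _ _ => 0
  | .E _ i _ => if i = 0 ∨ i = M then 1 else 0

/-- `K_i^{ε}` in the free algebra (`0` outside the range of indices, which is never used). -/
def freeK (M N : ℕ) (ε : ℤˣ) (i : ℕ) : FreeAlgebra ℂ (AffGen M N) :=
  if h : i < M + N then FreeAlgebra.ι ℂ (.K ε i h) else 0

/-- `E_i^{ε}` in the free algebra (`0` outside the range of indices, which is never used). -/
def freeE (M N : ℕ) (ε : ℤˣ) (i : ℕ) : HomElt (FreeAlgebra ℂ (AffGen M N)) :=
  ⟨if i = 0 ∨ i = M then 1 else 0,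
    if h : i < M + N then FreeAlgebra.ι ℂ (.E ε i h) else 0⟩

/-- The defining relations of `U_q'(𝔰𝔩(M, N)^)`. The nodes form a cycle, so the node after
`M` is read modulo `M + N` (it is the node `0` if `N = 1`). -/
inductive AffRel (q : ℂ) (M N : ℕ) :
    FreeAlgebra ℂ (AffGen M N) → FreeAlgebra ℂ (AffGen M N) → Prop
  | K_inv (ε : ℤˣ) (i : ℕ) (hi : i < M + N) :
      AffRel q M N (freeK M N ε i * freeK M N (-ε) i) 1
  | K_comm (i j : ℕ) (hi : i < M + N) (hj : j < M + N) :
      AffRel q M N (freeK M N 1 i * freeK M N 1 j) (freeK M N 1 j * freeK M N 1 i)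
  | K_E (ε : ℤˣ) (i j : ℕ) (hi : i < M + N) (hj : j < M + N) :
      AffRel q M N (freeK M N 1 i * (freeE M N ε j).val * freeK M N (-1) i)
        (q ^ ((ε : ℤ) * affCartan M N i j) • (freeE M N ε j).val)
  | E_cross_same (i : ℕ) (hi : i < M + N) :
      AffRel q M N (sbr 1 (freeE M N 1 i) (freeE M N (-1) i)).val
        ((qi q M i - (qi q M i)⁻¹)⁻¹ • (freeK M N 1 i - freeK M N (-1) i))
  | E_cross (i j : ℕ) (hi : i < M + N) (hj : j < M + N) (hij : i ≠ j) :
      AffRel q M N (sbr 1 (freeE M N 1 i) (freeE M N (-1) j)).val 0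
  | E_comm (ε : ℤˣ) (i j : ℕ) (hi : i < M + N) (hj : j < M + N)
      (hc : affCartan M N i j = 0) :
      AffRel q M N (sbr 1 (freeE M N ε i) (freeE M N ε j)).val 0
  | serre (ε : ℤˣ) (i j : ℕ) (hi : i < M + N) (hj : j < M + N)
      (hc : affCartan M N i j = 1 ∨ affCartan M N i j = -1) (h0 : i ≠ 0) (hM : i ≠ M) :
      AffRel q M N
        (sbr q (freeE M N ε i) (sbr q⁻¹ (freeE M N ε i) (freeE M N ε j))).val 0
  | quartic_M (ε : ℤˣ) (h : 3 < M + N) :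
      AffRel q M N
        (sbr 1 (sbr q (sbr q⁻¹ (freeE M N ε (M - 1)) (freeE M N ε M))
          (freeE M N ε ((M + 1) % (M + N)))) (freeE M N ε M)).val 0
  | quartic_zero (ε : ℤˣ) (h : 3 < M + N) :
      AffRel q M N
        (sbr 1 (sbr q (sbr q⁻¹ (freeE M N ε 1) (freeE M N ε 0))
          (freeE M N ε (M + N - 1))) (freeE M N ε 0)).val 0
  | quintic (ε : ℤˣ) (hM : M = 2) (hN : N = 1) :
      AffRel q M N
        (sbr q⁻¹ (freeE M N ε 0) (sbr 1 (freeE M N ε 2) (sbr 1 (freeE M N ε 0)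
          (sbr q (freeE M N ε 2) (freeE M N ε 1))))).val
        (sbr q⁻¹ (freeE M N ε 2) (sbr 1 (freeE M N ε 0) (sbr 1 (freeE M N ε 2)
          (sbr q (freeE M N ε 0) (freeE M N ε 1))))).val

/-- The algebra underlying `U_q'(𝔰𝔩(M, N)^)`. -/
abbrev UAff (q : ℂ) (M N : ℕ) : Type := RingQuot (AffRel q M N)

/-- The `ℤ/2`-grading of `U_q'(𝔰𝔩(M, N)^)`. -/
abbrev affGrading (q : ℂ) (M N : ℕ) : ZMod 2 → Submodule ℂ (UAff q M N) :=
  part AffGen.deg (AffRel q M N)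

/-- `K_i^{ε}` in `U_q'(𝔰𝔩(M, N)^)`. -/
def K (q : ℂ) (M N : ℕ) (ε : ℤˣ) (i : ℕ) : UAff q M N :=
  RingQuot.mkAlgHom ℂ (AffRel q M N) (freeK M N ε i)

/-- `E_i^{ε}` in `U_q'(𝔰𝔩(M, N)^)`, with its degree. -/
def E (q : ℂ) (M N : ℕ) (ε : ℤˣ) (i : ℕ) : HomElt (UAff q M N) :=
  (freeE M N ε i).map (RingQuot.mkAlgHom ℂ (AffRel q M N))

/-! ### The relations are homogeneous, so both algebras are superalgebras -/

theorem freeT_mem (M N : ℕ) (ε : ℤˣ) (i : ℕ) : freeT M N ε i ∈ freePart GlGen.deg 0 := by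
  unfold freeT
  split_ifs with h
  · exact freePart_ι GlGen.deg (.t ε i h)
  · exact Submodule.zero_mem _

theorem freee_homog (M N : ℕ) (ε : ℤˣ) (j : ℕ) : IsHomog GlGen.deg (freee M N ε j) := by
  unfold freee IsHomog
  dsimp only
  by_cases h : 1 ≤ j ∧ j < M + N
  · rw [dif_pos h]
    exact freePart_ι GlGen.deg (.e ε j h)
  · rw [dif_neg h]
    exact Submodule.zero_mem _

theorem freeK_mem (M N : ℕ) (ε : ℤˣ) (i : ℕ) : freeK M N ε i ∈ freePart AffGen.deg 0 := by
  unfold freeK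
  split_ifs with h
  · exact freePart_ι AffGen.deg (.K ε i h)
  · exact Submodule.zero_mem _

theorem freeE_homog (M N : ℕ) (ε : ℤˣ) (i : ℕ) : IsHomog AffGen.deg (freeE M N ε i) := by
  unfold freeE IsHomog
  dsimp only
  by_cases h : i < M + N
  · rw [dif_pos h]
    exact freePart_ι AffGen.deg (.E ε i h)
  · rw [dif_neg h]
    exact Submodule.zero_mem _

theorem freePart_mul_zero {X : Type*} {p : X → ZMod 2} {a b : FreeAlgebra ℂ X}
    (ha : a ∈ freePart p 0) (hb : b ∈ freePart p 0) : a * b ∈ freePart p 0 := by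
  simpa using freePart_mul p ha hb

theorem freePart_conj {X : Type*} {p : X → ZMod 2} {i : ZMod 2} {a b c : FreeAlgebra ℂ X}
    (ha : a ∈ freePart p 0) (hb : b ∈ freePart p i) (hc : c ∈ freePart p 0) :
    a * b * c ∈ freePart p i := by
  simpa using freePart_mul p (freePart_mul p ha hb) hc

theorem add_self_deg (i : ZMod 2) : i + i = 0 := CharTwo.add_self_eq_zero i

theorem glRel_homog (q : ℂ) (M N : ℕ) : HomogRel GlGen.deg (GlRel q M N) := by
  have ht := freeT_mem M N
  have he := freee_homog M N
  intro a b hab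
  cases hab with
  | t_inv ε i hi => exact ⟨0, freePart_mul_zero (ht _ _) (ht _ _), freePart_one _⟩
  | t_comm i i' hi hi' =>
    exact ⟨0, freePart_mul_zero (ht _ _) (ht _ _), freePart_mul_zero (ht _ _) (ht _ _)⟩
  | t_e ε i j hi hj =>
    exact ⟨_, freePart_conj (ht _ _) (he ε j) (ht _ _), Submodule.smul_mem _ _ (he ε j)⟩
  | e_cross_same j hj =>
    refine ⟨0, ?_, Submodule.smul_mem _ _ (Submodule.sub_mem _
      (freePart_mul_zero (ht _ _) (ht _ _)) (freePart_mul_zero (ht _ _) (ht _ _)))⟩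
    have h := (he 1 j).sbr 1 (he (-1) j)
    unfold IsHomog at h
    rwa [show (sbr 1 (freee M N 1 j) (freee M N (-1) j)).deg = 0 from add_self_deg _] at h
  | e_cross j k hj hk hjk => exact ⟨_, (he _ _).sbr _ (he _ _), Submodule.zero_mem _⟩
  | e_comm ε j k hj hk hc => exact ⟨_, (he _ _).sbr _ (he _ _), Submodule.zero_mem _⟩
  | serre ε j k hj hk hc hM =>
    exact ⟨_, (he _ _).sbr _ ((he _ _).sbr _ (he _ _)), Submodule.zero_mem _⟩
  | quartic ε hM hN =>
    exact ⟨_, (((he _ _).sbr _ (he _ _)).sbr _ (he _ _)).sbr _ (he _ _), Submodule.zero_mem _⟩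

theorem affRel_homog (q : ℂ) (M N : ℕ) : HomogRel AffGen.deg (AffRel q M N) := by
  have ht := freeK_mem M N
  have he := freeE_homog M N
  intro a b hab
  cases hab with
  | K_inv ε i hi => exact ⟨0, freePart_mul_zero (ht _ _) (ht _ _), freePart_one _⟩
  | K_comm i i' hi hi' =>
    exact ⟨0, freePart_mul_zero (ht _ _) (ht _ _), freePart_mul_zero (ht _ _) (ht _ _)⟩
  | K_E ε i j hi hj =>
    exact ⟨_, freePart_conj (ht _ _) (he ε j) (ht _ _), Submodule.smul_mem _ _ (he ε j)⟩
  | E_cross_same j hj =>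
    refine ⟨0, ?_, Submodule.smul_mem _ _ (Submodule.sub_mem _ (ht _ _) (ht _ _))⟩
    have h := (he 1 j).sbr 1 (he (-1) j)
    unfold IsHomog at h
    rwa [show (sbr 1 (freeE M N 1 j) (freeE M N (-1) j)).deg = 0 from add_self_deg _] at h
  | E_cross j k hj hk hjk => exact ⟨_, (he _ _).sbr _ (he _ _), Submodule.zero_mem _⟩
  | E_comm ε j k hj hk hc => exact ⟨_, (he _ _).sbr _ (he _ _), Submodule.zero_mem _⟩
  | serre ε j k hj hk hc h0 hM =>
    exact ⟨_, (he _ _).sbr _ ((he _ _).sbr _ (he _ _)), Submodule.zero_mem _⟩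
  | quartic_M ε h =>
    exact ⟨_, (((he _ _).sbr _ (he _ _)).sbr _ (he _ _)).sbr _ (he _ _), Submodule.zero_mem _⟩
  | quartic_zero ε h =>
    exact ⟨_, (((he _ _).sbr _ (he _ _)).sbr _ (he _ _)).sbr _ (he _ _), Submodule.zero_mem _⟩
  | quintic ε hM hN =>
    subst hM hN
    have h1 := (he ε 0).sbr q⁻¹ ((he ε 2).sbr 1 ((he ε 0).sbr 1 ((he ε 2).sbr q (he ε 1))))
    have h2 := (he ε 2).sbr q⁻¹ ((he ε 0).sbr 1 ((he ε 2).sbr 1 ((he ε 0).sbr q (he ε 1))))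
    exact ⟨_, h1, h2⟩

instance glGraded (q : ℂ) (M N : ℕ) : GradedAlgebra (glGrading q M N) :=
  gradedAlgebra GlGen.deg (GlRel q M N) (glRel_homog q M N)

instance affGraded (q : ℂ) (M N : ℕ) : GradedAlgebra (affGrading q M N) :=
  gradedAlgebra AffGen.deg (AffRel q M N) (affRel_homog q M N)

end QSuper

end

/-! Since the affine algebra is presented by generators and relations, it is enough to check each
relation on the proposed images, and then that generators go to elements of the right parity. The
check takes place in an arbitrary algebra carrying elements with the `𝔤𝔩` relations (`GlRep`), with
n = M + N and the signs ε = ± treated together. Up to a scalar, E_0^ε goes to z^ε = x · (t_1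
t_n⁻¹)^ε, where x is the iterated bracket of e_1^{-ε}, …, e_{n-1}^{-ε}, a root vector of weight
-ε(ε_1 - ε_n). Three facts about root vectors built on an interval of nodes carry the argument. (1)
A generator at an interior node supercommutes with the root vector, whichever its sign
(`e_qComm_seg_inner`, `e_cross_qComm_seg_inner`). The same-sign case on three nodes is the quartic
relation at M and a consequence of two Serre relations elsewhere. (2) A generator of the same sign
at an end node commutes with it up to a power of q, and up to a sign at M (`e_qComm_seg_left`,
`seg_qComm_e_right`, `seg_qComm_e_right_odd`). The torus factor of z^ε cancels that power, so z^ε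
supercommutes with every e_j^{-ε}. (3) Bracketing with a generator of opposite sign at an end node
removes that node and leaves a Cartan factor (`cross_seg_left`, `cross_seg_right`). The Serre
relations with E_0 follow from (3) and weights. In the quartic relation at 0 both ends are stripped,
and what remains supercommutes with z^ε by (1). The quartic relation at M is the `𝔤𝔩` one with q and
q⁻¹ exchanged (`quartic_symm`) or, for N = 1, comes from stripping two nodes. The quintic relation
for (2, 1) is a computation in normal order. All relations but one are homogeneous in E_0^ε of a
fixed sign, hence blind to its scalar. The exception is [E_0^+, E_0^-]: there `br_seg_seg` evaluates
the bracket of opposite root vectors by induction, and (-q)^{N-M} is the factor that normalises it.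
-/

noncomputable section

namespace QSuper

/-! ### Calculus of q-commutators and Serre relations -/

section Brackets

variable {A : Type*} [Ring A] [Algebra ℂ A]

/-- The `c`-commutator `x y - c y x`. -/
def br (c : ℂ) (x y : A) : A := x * y - c • (y * x)

/-- `x` and `y` commute up to the scalar `c`. -/
def QComm (c : ℂ) (x y : A) : Prop := x * y = c • (y * x)

namespace QComm

variable {c d : ℂ} {x y z : A}

theorem eq (h : QComm c x y) : x * y = c • (y * x) := h

theorem assoc (h : QComm c x y) (w : A) : x * (y * w) = c • (y * (x * w)) := by
  rw [← mul_assoc, h.eq, smul_mul_assoc, mul_assoc]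

theorem congr (h : QComm c x y) (hc : c = d) : QComm d x y := hc ▸ h

theorem mul_left (hx : QComm c x z) (hy : QComm d y z) : QComm (c * d) (x * y) z := by
  unfold QComm
  rw [mul_assoc, hy.eq, mul_smul_comm, hx.assoc, smul_smul, mul_comm d c]

theorem mul_right (hx : QComm c z x) (hy : QComm d z y) : QComm (c * d) z (x * y) := by
  unfold QComm
  rw [hx.assoc, hy.eq, mul_smul_comm, smul_smul, mul_assoc]

theorem smul_left (a : ℂ) (h : QComm c x y) : QComm c (a • x) y := by
  unfold QComm
  rw [smul_mul_assoc, h.eq, mul_smul_comm, smul_comm]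

theorem smul_right (a : ℂ) (h : QComm c x y) : QComm c x (a • y) := by
  unfold QComm
  rw [smul_mul_assoc, mul_smul_comm, h.eq, smul_comm]

theorem sub_right (hx : QComm c z x) (hy : QComm c z y) : QComm c z (x - y) := by
  unfold QComm
  rw [mul_sub, sub_mul, hx.eq, hy.eq, smul_sub]

theorem sub_left (hx : QComm c x z) (hy : QComm c y z) : QComm c (x - y) z := by
  unfold QComm
  rw [mul_sub, sub_mul, hx.eq, hy.eq, smul_sub]

theorem symm (hc : c ≠ 0) (h : QComm c x y) : QComm c⁻¹ y x := by
  unfold QComm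
  rw [h.eq, smul_smul, inv_mul_cancel₀ hc, one_smul]

theorem of_commute (h : x * y = y * x) : QComm 1 x y := by
  unfold QComm
  rw [one_smul, h]

theorem commute (h : QComm 1 x y) : x * y = y * x := by
  rw [h.eq, one_smul]

theorem br_right (u : ℂ) (hx : QComm c z x) (hy : QComm d z y) : QComm (c * d) z (br u x y) :=
  (hx.mul_right hy).sub_right (((hy.mul_right hx).smul_right u).congr (mul_comm _ _))

theorem br_left (u : ℂ) (hx : QComm c x z) (hy : QComm d y z) : QComm (c * d) (br u x y) z :=
  (hx.mul_left hy).sub_left (((hy.mul_left hx).smul_left u).congr (mul_comm _ _))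

end QComm

variable {c : ℂ} {x y z : A}

/-- After expansion the two sides differ only in the order of x and z where these are adjacent. This
reassociation allows a root vector to be peeled from its left end as well as from its right. -/
theorem br_br_of_commute (c d : ℂ) (h : x * z = z * x) :
    br d (br c x y) z = br c x (br d y z) := by
  have h' : ∀ w, x * (z * w) = z * (x * w) := fun w => by rw [← mul_assoc, h, mul_assoc]
  simp only [br, mul_sub, sub_mul, smul_sub, smul_mul_assoc, mul_smul_comm, mul_assoc, h, h']
  module

/-- The quantum Serre relation between `y` and `x`. -/
def Serre (c : ℂ) (y x : A) : Prop :=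
  y * (y * x) - (c + c⁻¹) • (y * (x * y)) + x * (y * y) = 0

theorem Serre.inv (h : Serre c y x) : Serre c⁻¹ y x := by
  unfold Serre at *
  rwa [inv_inv, add_comm c⁻¹]

theorem br_br_self (hc : c ≠ 0) (x y : A) :
    br c y (br c⁻¹ y x) = y * (y * x) - (c + c⁻¹) • (y * (x * y)) + x * (y * y) := by
  simp only [br, mul_sub, sub_mul, smul_sub, smul_mul_assoc, mul_smul_comm, mul_assoc]
  match_scalars <;> field_simp
  ring

/-- The Serre expression is itself the outer c⁻¹-commutator of y with the inner c-commutator. -/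
theorem Serre.qComm_left (hc : c ≠ 0) (h : Serre c y x) : QComm c⁻¹ y (br c y x) := by
  unfold Serre at h
  rw [QComm, ← sub_eq_zero, ← h]
  simp only [br, mul_sub, sub_mul, smul_sub, smul_mul_assoc, mul_smul_comm, mul_assoc]
  match_scalars <;> field_simp
  ring

theorem Serre.qComm_right (hc : c ≠ 0) (h : Serre c y x) : QComm c⁻¹ (br c x y) y := by
  unfold Serre at h
  rw [QComm, ← sub_eq_zero, ← h]
  simp only [br, mul_sub, sub_mul, smul_sub, smul_mul_assoc, mul_smul_comm, mul_assoc]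
  match_scalars <;> field_simp
  ring

/-- The commutator multiplied by c + c⁻¹ is a combination of the Serre expressions of (y, x) and (y,
z), multiplied by z and x on either side; c² ≠ -1 allows the division. -/
theorem commute_br_br (hc : c ≠ 0) (hc2 : c ^ 2 + 1 ≠ 0) (hx : Serre c y x) (hz : Serre c y z)
    (hxz : x * z = z * x) : y * br c (br c x y) z = br c (br c x y) z * y := by
  have hxz' : ∀ w, x * (z * w) = z * (x * w) := fun w => by rw [← mul_assoc, hxz, mul_assoc]
  have key : (c + c⁻¹) • (br c (br c x y) z * y - y * br c (br c x y) z) =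
      (y * (y * x) - (c + c⁻¹) • (y * (x * y)) + x * (y * y)) * z
      - c ^ 2 • (z * (y * (y * x) - (c + c⁻¹) • (y * (x * y)) + x * (y * y)))
      - x * (y * (y * z) - (c + c⁻¹) • (y * (z * y)) + z * (y * y))
      + c ^ 2 • ((y * (y * z) - (c + c⁻¹) • (y * (z * y)) + z * (y * y)) * x) := by
    simp only [br, mul_sub, sub_mul, mul_add, add_mul, smul_sub, smul_add, smul_mul_assoc,
      mul_smul_comm, mul_assoc, hxz, hxz']
    match_scalars <;> field_simp <;> ring
  have hk : c + c⁻¹ ≠ 0 := by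
    intro h
    apply hc2
    field_simp at h
    simpa using h
  rw [hx, hz] at key
  simp only [zero_mul, mul_zero, smul_zero, sub_zero, add_zero] at key
  exact (sub_eq_zero.1 ((smul_eq_zero.1 key).resolve_left hk)).symm

/-- The quartic expression in `x, y, z` is symmetric under `q ↔ q⁻¹` when `y² = 0`. -/
theorem quartic_symm {a b s : ℂ} (hs : s * s = 1) (hy : y * y = 0)
    (hxz : x * z = z * x) :
    br (-s) (br (s * b) (br a x y) z) y = br (-s) (br (s * a) (br b x y) z) y := by
  have hy' : ∀ w, y * (y * w) = 0 := fun w => by rw [← mul_assoc, hy, zero_mul]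
  simp only [br, mul_sub, sub_mul, smul_sub, smul_mul_assoc, mul_smul_comm, mul_assoc, hxz, hy, hy', mul_zero, smul_zero, sub_zero]
  -- Every coefficient is symmetric in a and b except that of y x z y, which is -(a + s² b).
  match_scalars
  all_goals first | ring1 | linear_combination (a - b) * hs

/-- If `h² = 0` then `(h g - c g h)² = 0`, given one `q`-commutation. -/
theorem sq_br_right (hc2 : c ^ 2 + 1 ≠ 0) (hc : c ≠ 0) {h g : A} (hh : h * h = 0)
    (hg : QComm c⁻¹ (br c h g) g) : br c h g * br c h g = 0 := by
  have h1 : g * br c h g = c • (br c h g * g) := by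
    rw [hg.eq, smul_smul, mul_inv_cancel₀ hc, one_smul]
  have h2 : h * br c h g = -(c • (br c h g * h)) := by
    simp only [br, mul_sub, sub_mul, smul_sub, smul_mul_assoc, mul_smul_comm, mul_assoc, hh,
      ← mul_assoc h h, zero_mul, mul_zero, smul_zero]
    module
  -- Expanding the left factor of the square and moving the right factor W = `br c h g` to the front
  -- gives W² = -c² W².
  have key : (c ^ 2 + 1) • (br c h g * br c h g) = 0 := by
    have e : br c h g * br c h g = h * (g * br c h g) - c • (g * (h * br c h g)) := by
      conv_lhs => enter [1]; rw [br]
      rw [sub_mul, smul_mul_assoc, mul_assoc, mul_assoc]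
    have e2 : h * (g * br c h g) = -(c ^ 2 • (br c h g * (h * g))) := by
      rw [h1, mul_smul_comm, ← mul_assoc, h2, neg_mul, smul_mul_assoc, mul_assoc]
      module
    have e3 : g * (h * br c h g) = -(c ^ 2 • (br c h g * (g * h))) := by
      rw [h2, mul_neg, mul_smul_comm, ← mul_assoc, h1, smul_mul_assoc, mul_assoc]
      module
    have e4 : br c h g * br c h g = br c h g * (h * g) - c • (br c h g * (g * h)) := by
      conv_lhs => enter [2]; rw [br]
      rw [mul_sub, mul_smul_comm]
    rw [e2, e3] at e
    rw [add_smul, one_smul]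
    nth_rewrite 2 [e]
    rw [e4]
    module
  exact (smul_eq_zero.1 key).resolve_left hc2

/-- If `h² = 0` then `(g h - c h g)² = 0`, given one `q`-commutation. -/
theorem sq_br_left (hc2 : c ^ 2 + 1 ≠ 0) (hc : c ≠ 0) {h g : A} (hh : h * h = 0)
    (hg : QComm c⁻¹ g (br c g h)) : br c g h * br c g h = 0 := by
  have hci : c⁻¹ ≠ 0 := inv_ne_zero hc
  have hc2i : c⁻¹ ^ 2 + 1 ≠ 0 := by
    intro h0
    apply hc2
    field_simp at h0
    simpa [add_comm] using h0
  have e : br c g h = (-c) • br c⁻¹ h g := by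
    simp only [br, smul_sub, smul_smul]
    match_scalars <;> field_simp
  have h0 := sq_br_right hc2i hci hh (g := g) (by
    rw [inv_inv]
    have : br c⁻¹ h g = (-c)⁻¹ • br c g h := by
      rw [e, smul_smul, inv_mul_cancel₀ (neg_ne_zero.2 hc), one_smul]
    rw [this]
    exact ((hg.symm hci).congr (inv_inv c)).smul_left _)
  rw [e, smul_mul_assoc, mul_smul_comm, h0, smul_zero, smul_zero]

end Brackets

/-! ### Brackets between raising and lowering elements -/

section CrossBrackets

variable {A : Type*} [Ring A] [Algebra ℂ A] {c h σ : ℂ} {e f g X K K' : A}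

theorem br_eq_zero_iff : br c e f = 0 ↔ QComm c e f := sub_eq_zero

/-- As e commutes with X, the bracket is the c-commutator of X with h(K - K'). The parameter c is
exactly the one for which the K' term cancels. -/
theorem br_cross_right (hX : e * X = X * e) (hef : br σ e f = h • (K - K')) (hc : c ≠ 0)
    (hK : QComm c K X) (hK' : QComm c⁻¹ K' X) :
    br σ e (br c X f) = (h * (1 - c ^ 2)) • (X * K) := by
  have e1 : br σ e (br c X f) = X * br σ e f - c • (br σ e f * X) := by
    have hX' : ∀ w, e * (X * w) = X * (e * w) := fun w => by rw [← mul_assoc, hX, mul_assoc]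
    simp only [br, mul_sub, sub_mul, smul_sub, smul_mul_assoc, mul_smul_comm, mul_assoc, hX, hX']
    module
  rw [e1, hef, smul_mul_assoc, mul_smul_comm, mul_sub, sub_mul, hK.eq, hK'.eq]
  match_scalars <;> field_simp
  ring

/-- Mirror image of `br_cross_right`: here the K term cancels and K' survives. -/
theorem br_cross_left (hX : e * X = X * e) (hef : br σ e f = h • (K - K')) (hc : c ≠ 0)
    (hK : QComm c K X) (hK' : QComm c⁻¹ K' X) :
    br σ e (br c f X) = (h * (c - c⁻¹)) • (X * K') := by
  have e1 : br σ e (br c f X) = br σ e f * X - c • (X * br σ e f) := by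
    have hX' : ∀ w, e * (X * w) = X * (e * w) := fun w => by rw [← mul_assoc, hX, mul_assoc]
    simp only [br, mul_sub, sub_mul, smul_sub, smul_mul_assoc, mul_smul_comm, mul_assoc, hX, hX']
    module
  rw [e1, hef, smul_mul_assoc, mul_smul_comm, mul_sub, sub_mul, hK.eq, hK'.eq]
  match_scalars <;> field_simp <;> ring

/-- Since e passes through g, bracketing with e acts on X alone, and the hypothesis kills the outer
c-commutator. -/
theorem br_cross_inner (hg : e * g = g * e) (h : QComm c (br σ e X) g) :
    QComm σ e (br c X g) := by
  have hg' : ∀ w, e * (g * w) = g * (e * w) := fun w => by rw [← mul_assoc, hg, mul_assoc]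
  have h' := h.eq
  rw [QComm, ← sub_eq_zero]
  rw [← sub_eq_zero] at h'
  rw [← h']
  simp only [br, mul_sub, sub_mul, smul_sub, smul_mul_assoc, mul_smul_comm, mul_assoc, hg, hg']
  module

/-- Inductive step for the bracket of opposite root vectors. With W = [X, f]_c, the brackets [e, W]
and [Y, W] each reduce to one term, X K and f H' up to scalars. The Leibniz rule then gives [Y, X] K
and [e, f] H', whose mixed terms H' K cancel. -/
theorem br_br_cross {s r : ℂ} {Y X e f K K' H H' : A} (hc : c ≠ 0) (hcc : c - c⁻¹ ≠ 0)
    (hYf : Y * f = f * Y) (heX : e * X = X * e) (hef : br σ e f = (c - c⁻¹)⁻¹ • (K - K'))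
    (hYX : br s Y X = r • (H - H')) (hKX : QComm c K X) (hK'X : QComm c⁻¹ K' X)
    (hKY : QComm c⁻¹ K Y) (hHf : QComm c H f) (hH'f : QComm c⁻¹ H' f) (hH'e : QComm c H' e)
    (hH'K : K * H' = H' * K) (hHK : K' * H' = H' * K') :
    br (s * σ) (br c Y e) (br c X f) = (-(c * r)) • (H * K - H' * K') := by
  have h1 := br_cross_right heX hef hc hKX hK'X
  have h2 : br s Y (br c X f) = (r * (c - c⁻¹)) • (f * H') := by
    have hYf' : ∀ w, Y * (f * w) = f * (Y * w) := fun w => by rw [← mul_assoc, hYf, mul_assoc]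
    have : br s Y (br c X f) = br s Y X * f - c • (f * br s Y X) := by
      simp only [br, mul_sub, sub_mul, smul_sub, smul_mul_assoc, mul_smul_comm, mul_assoc, hYf,
        hYf']
      module
    rw [this, hYX, smul_mul_assoc, mul_smul_comm, mul_sub, sub_mul, hHf.eq, hH'f.eq]
    match_scalars <;> field_simp <;> ring
  have h1c : (c - c⁻¹)⁻¹ * (1 - c ^ 2) = -c := by
    have : 1 - c ^ 2 = -c * (c - c⁻¹) := by field_simp; ring
    rw [this, mul_comm, mul_assoc, mul_inv_cancel₀ hcc, mul_one]
  rw [h1c] at h1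
  generalize hW : br c X f = W at *
  have e1 : br (s * σ) (br c Y e) W = Y * br σ e W + σ • (br s Y W * e)
      - c • (e * br s Y W) - (c * s) • (br σ e W * Y) := by
    simp only [br, mul_sub, sub_mul, smul_sub, smul_mul_assoc, mul_smul_comm, mul_assoc]
    module
  have e2 : br (s * σ) (br c Y e) W =
      (-c) • (br s Y X * K) - (r * (c - c⁻¹) * c) • (br σ e f * H') := by
    rw [e1, h1, h2]
    simp only [br, mul_sub, sub_mul, smul_sub, smul_mul_assoc, mul_smul_comm, mul_assoc, hKY.eq,
      hH'e.eq]
    match_scalars <;> field_simp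
  have h2c : r * (c - c⁻¹) * c * (c - c⁻¹)⁻¹ = r * c := by
    rw [mul_right_comm, mul_assoc r, mul_inv_cancel₀ hcc, mul_one]
  rw [e2, hYX, hef, smul_mul_assoc, smul_mul_assoc, smul_smul (r * (c - c⁻¹) * c), h2c]
  simp only [sub_mul, hH'K, hHK]
  module

end CrossBrackets

/-! ### Weights, and root vectors in an algebra with the `𝔤𝔩` relations -/

/-- Kronecker's symbol, as an integer. -/
def ind (i j : ℕ) : ℤ := if i = j then 1 else 0

/-- The sign `(-1)^{|e_j|}`. -/
def sg (M j : ℕ) : ℂ := if j = M then -1 else 1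

theorem sg_mul_self (M j : ℕ) : sg M j * sg M j = 1 := by
  unfold sg; split_ifs <;> norm_num

theorem l_coe (M i : ℕ) : ((l M i : ℤˣ) : ℤ) = if i ≤ M then 1 else -1 := by
  unfold l; split_ifs <;> rfl

/-- The exponent of the commutation of `K_j` with a root vector of weight `ε_a - ε_b`. -/
def kWeight (M j a b : ℕ) : ℤ :=
  l M j * (ind j a - ind j b) - l M (j + 1) * (ind (j + 1) a - ind (j + 1) b)

/-- The exponent of the commutation of `t_1 t_n⁻¹` with a root vector of weight `ε_a - ε_b`. -/
def topWeight (n a b : ℕ) : ℤ := (ind 1 a - ind 1 b) - (ind n a - ind n b)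

/-- Elements of an algebra that satisfy the relations of `U_q(𝔤𝔩(M, n - M))`. -/
structure GlRep (q : ℂ) (M n : ℕ) (A : Type*) [Ring A] [Algebra ℂ A] where
  t : ℤˣ → ℕ → A
  e : ℤˣ → ℕ → A
  q_ne : q ≠ 0
  sq_ne_one : q ^ 2 ≠ 1
  sq_add_one_ne : q ^ 2 + 1 ≠ 0
  one_lt : 1 < M
  lt : M < n
  t_inv : ∀ ε i, 1 ≤ i → i ≤ n → t ε i * t (-ε) i = 1
  t_comm : ∀ ε δ i j, t ε i * t δ j = t δ j * t ε i
  t_e : ∀ (δ ε : ℤˣ) i j,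
    QComm (q ^ ((δ : ℤ) * (ε : ℤ) * (ind i j - ind i (j + 1)))) (t δ i) (e ε j)
  cross : ∀ ε j k, j ≠ k → e ε j * e (-ε) k = e (-ε) k * e ε j
  cross_same : ∀ ε j, br (sg M j) (e ε j) (e (-ε) j) =
    ((if ε = 1 then 1 else sg M j) * (qi q M j - (qi q M j)⁻¹)⁻¹) •
      (t (ε * l M j) j * t (-(ε * l M (j + 1))) (j + 1) -
        t (-ε * l M j) j * t (-(-ε * l M (j + 1))) (j + 1))
  comm : ∀ ε j k, j + 1 < k → e ε j * e ε k = e ε k * e ε j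
  sq : ∀ ε, e ε M * e ε M = 0
  serre : ∀ ε j k, j ≠ M → (k = j + 1 ∨ j = k + 1) → Serre q (e ε j) (e ε k)
  quartic : ∀ ε, QComm (-1) (e ε M)
    (br q⁻¹ (br q (e ε (M - 1)) (e ε M)) (e ε (M + 1)))

namespace GlRep

variable {q : ℂ} {M n : ℕ} {A : Type*} [Ring A] [Algebra ℂ A] (D : GlRep q M n A)

/-- The Cartan element `K_j^δ`. -/
def K (δ : ℤˣ) (j : ℕ) : A := D.t (δ * l M j) j * D.t (-(δ * l M (j + 1))) (j + 1)

/-- The Cartan element `(t_1 t_n⁻¹)^δ`. -/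
def T (δ : ℤˣ) : A := D.t δ 1 * D.t (-δ) n

/-- The root vector `[⋯[e_a, e_{a+1}]_{q_{a+1}}, ⋯, e_{a+k}]_{q_{a+k}}`. -/
def seg (ε : ℤˣ) (a : ℕ) : ℕ → A
  | 0 => D.e ε a
  | k + 1 => br (qi q M (a + k + 1)) (seg ε a k) (D.e ε (a + k + 1))

variable {ε δ : ℤˣ} {a b j k : ℕ}

theorem q_sub_inv_ne (D : GlRep q M n A) : q - q⁻¹ ≠ 0 := by
  intro h
  apply D.sq_ne_one
  have := D.q_ne
  rw [sub_eq_zero] at h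
  rw [pow_two]
  nth_rewrite 2 [h]
  exact mul_inv_cancel₀ this

theorem qi_ne (D : GlRep q M n A) (j : ℕ) : qi q M j ≠ 0 := zpow_ne_zero _ D.q_ne

theorem qi_of_le {q : ℂ} (h : j ≤ M) : qi q M j = q := by
  rw [qi, l_coe, if_pos h, zpow_one]

theorem qi_of_lt {q : ℂ} (h : M < j) : qi q M j = q⁻¹ := by
  rw [qi, l_coe, if_neg (by omega), zpow_neg_one]

theorem qi_sub_inv_ne (D : GlRep q M n A) (j : ℕ) : qi q M j - (qi q M j)⁻¹ ≠ 0 := by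
  rcases le_or_gt j M with h | h
  · rw [qi_of_le h]; exact D.q_sub_inv_ne
  · rw [qi_of_lt h, inv_inv, ← neg_sub]; exact neg_ne_zero.2 D.q_sub_inv_ne

theorem qi_sq_add_one_ne (D : GlRep q M n A) (j : ℕ) : qi q M j ^ 2 + 1 ≠ 0 := by
  rcases le_or_gt j M with h | h
  · rw [qi_of_le h]; exact D.sq_add_one_ne
  · rw [qi_of_lt h]
    intro h0
    have := D.q_ne
    apply D.sq_add_one_ne
    field_simp at h0
    simpa [add_comm] using h0

theorem serre_qi (m : ℕ) (hj : j ≠ M) (hk : k = j + 1 ∨ j = k + 1) :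
    Serre (qi q M m) (D.e ε j) (D.e ε k) := by
  rcases le_or_gt m M with h | h
  · rw [qi_of_le h]; exact D.serre _ _ _ hj hk
  · rw [qi_of_lt h]; exact (D.serre _ _ _ hj hk).inv

theorem seg_succ (h : b = a + k + 1) :
    D.seg ε a (k + 1) = br (qi q M b) (D.seg ε a k) (D.e ε b) := by
  subst h; rfl

theorem seg_zero : D.seg ε a 0 = D.e ε a := rfl

/-! ### Commutation with the torus -/

theorem t_seg (δ ε : ℤˣ) (i a k : ℕ) :
    QComm (q ^ ((δ : ℤ) * (ε : ℤ) * (ind i a - ind i (a + k + 1)))) (D.t δ i) (D.seg ε a k) := by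
  induction k with
  | zero => exact D.t_e δ ε i a
  | succ k ih =>
    refine (ih.br_right _ (D.t_e δ ε i (a + k + 1))).congr ?_
    rw [← zpow_add₀ D.q_ne]
    congr 1
    rw [show a + (k + 1) + 1 = a + k + 1 + 1 by omega]
    ring

theorem t_t_seg (δ δ' ε : ℤˣ) (i i' a k : ℕ) (m : ℤ)
    (h : (ε : ℤ) * (δ * (ind i a - ind i (a + k + 1)) +
      δ' * (ind i' a - ind i' (a + k + 1))) = m) :
    QComm (q ^ m) (D.t δ i * D.t δ' i') (D.seg ε a k) := by
  refine ((D.t_seg _ ε _ a k).mul_left (D.t_seg _ ε _ a k)).congr ?_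
  rw [← zpow_add₀ D.q_ne, ← h]
  congr 1
  ring

theorem K_seg (δ ε : ℤˣ) (j a k : ℕ) (m : ℤ)
    (h : (δ : ℤ) * ε * kWeight M j a (a + k + 1) = m) :
    QComm (q ^ m) (D.K δ j) (D.seg ε a k) := by
  apply D.t_t_seg
  rw [← h]
  simp only [kWeight, Units.val_neg, Units.val_mul]
  ring

theorem T_seg (δ ε : ℤˣ) (a k : ℕ) (m : ℤ)
    (h : (δ : ℤ) * ε * topWeight n a (a + k + 1) = m) :
    QComm (q ^ m) (D.T δ) (D.seg ε a k) := by
  apply D.t_t_seg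
  rw [← h]
  simp only [topWeight, Units.val_neg]
  ring

theorem K_comm (i j : ℕ) (δ ε : ℤˣ) : D.K δ i * D.K ε j = D.K ε j * D.K δ i := by
  have h : ∀ ε δ i j, Commute (D.t ε i) (D.t δ j) := D.t_comm
  exact ((h _ _ _ _).mul_right (h _ _ _ _)).mul_left ((h _ _ _ _).mul_right (h _ _ _ _))

theorem K_T_comm (i : ℕ) (δ ε : ℤˣ) : D.K δ i * D.T ε = D.T ε * D.K δ i := by
  have h : ∀ ε δ i j, Commute (D.t ε i) (D.t δ j) := D.t_comm
  exact ((h _ _ _ _).mul_right (h _ _ _ _)).mul_left ((h _ _ _ _).mul_right (h _ _ _ _))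

theorem K_inv (δ : ℤˣ) (h1 : 1 ≤ j) (h2 : j < n) : D.K δ j * D.K (-δ) j = 1 := by
  have e1 := D.t_inv (δ * l M j) j h1 h2.le
  have e2 := D.t_inv (-(δ * l M (j + 1))) (j + 1) (by omega) h2
  rw [K, K, mul_assoc, ← mul_assoc (D.t _ (j + 1)), D.t_comm _ _ (j + 1) j, mul_assoc, neg_mul,
    neg_mul, e2, mul_one, e1]

theorem T_inv (δ : ℤˣ) : D.T δ * D.T (-δ) = 1 := by
  have := D.lt
  have e1 := D.t_inv δ 1 le_rfl (by omega)
  have e2 := D.t_inv (-δ) n (by omega) le_rfl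
  rw [T, T, mul_assoc, ← mul_assoc (D.t _ n), D.t_comm _ _ n 1, mul_assoc, e2, mul_one, e1]

/-! ### Commutation among root vectors of the same sign -/

theorem commute_seg_of {x : A} (h : ∀ j, a ≤ j → j ≤ a + k → x * D.e ε j = D.e ε j * x) :
    x * D.seg ε a k = D.seg ε a k * x := by
  induction k with
  | zero => exact h a le_rfl le_rfl
  | succ k ih =>
    have h1 := ih fun j h1 h2 => h j h1 (by omega)
    have h2 := h (a + k + 1) (by omega) (by omega)
    exact (((QComm.of_commute h1).br_right _ (QComm.of_commute h2)).congr (mul_one 1)).commute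

theorem e_comm_seg (h : j + 1 < a ∨ a + k + 1 < j) :
    D.e ε j * D.seg ε a k = D.seg ε a k * D.e ε j := by
  apply D.commute_seg_of
  intro i h1 h2
  rcases h with h | h
  · exact D.comm _ _ _ (by omega)
  · exact (D.comm _ _ _ (by omega)).symm

theorem e_cross_comm_seg (h : j < a ∨ a + k < j) :
    D.e ε j * D.seg (-ε) a k = D.seg (-ε) a k * D.e ε j := by
  apply D.commute_seg_of
  intro i h1 h2
  exact D.cross _ _ _ (by omega)

/-- The first and the last generator commute as soon as there are at least three nodes, so the
brackets can be regrouped. -/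
theorem seg_succ_left (h : b = a + 1) :
    D.seg ε a (k + 1) = br (qi q M b) (D.e ε a) (D.seg ε b k) := by
  subst h
  induction k with
  | zero => rfl
  | succ k ih =>
    rw [D.seg_succ (b := a + k + 2) (by omega), ih, D.seg_succ (b := a + k + 2) (by omega)]
    exact br_br_of_commute _ _ (D.comm _ _ _ (by omega))

/-- On the three nodes j - 1, j, j + 1 this is the quartic relation if j = M. Otherwise q_j =
q_{j+1} and the two Serre relations at j suffice. Further nodes on the right commute with e_j. -/
theorem e_qComm_seg_inner_aux (hj : j = a + 1) :
    QComm (sg M j) (D.e ε j) (D.seg ε a (k + 2)) := by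
  induction k with
  | zero =>
    rw [D.seg_succ (b := j + 1) (by omega), D.seg_succ (b := j) (by omega), seg_zero]
    by_cases h : j = M
    · subst h
      rw [sg, if_pos rfl, qi_of_le le_rfl, qi_of_lt (by omega)]
      have := D.quartic ε
      rwa [show j - 1 = a by omega] at this
    · rw [sg, if_neg h]
      apply QComm.of_commute
      have : qi q M (j + 1) = qi q M j := by
        rcases lt_or_gt_of_ne h with h | h
        · rw [qi_of_le (by omega), qi_of_le (by omega)]
        · rw [qi_of_lt (by omega), qi_of_lt (by omega)]
      rw [this]
      exact commute_br_br (D.qi_ne j) (D.qi_sq_add_one_ne j) (D.serre_qi j h (Or.inr hj))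
        (D.serre_qi j h (Or.inl rfl)) (D.comm _ _ _ (by omega))
  | succ k ih =>
    rw [D.seg_succ (b := a + k + 3) (by omega)]
    exact (ih.br_right _ (QComm.of_commute (D.comm _ _ _ (by omega)))).congr (mul_one _)

theorem e_qComm_seg_inner (h1 : a < j) (h2 : j < a + k) :
    QComm (sg M j) (D.e ε j) (D.seg ε a k) := by
  obtain ⟨d, rfl⟩ : ∃ d, j = a + d + 1 := ⟨j - a - 1, by omega⟩
  induction d generalizing a k with
  | zero =>
    obtain ⟨k, rfl⟩ : ∃ m, k = m + 2 := ⟨k - 2, by omega⟩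
    exact D.e_qComm_seg_inner_aux rfl
  | succ d ih =>
    obtain ⟨k, rfl⟩ : ∃ m, k = m + 1 := ⟨k - 1, by omega⟩
    rw [D.seg_succ_left (b := a + 1) rfl]
    have := ih (a := a + 1) (k := k) (by omega) (by omega)
    rw [show a + 1 + d + 1 = a + (d + 1) + 1 by omega] at this
    exact ((QComm.of_commute (D.comm _ _ _ (by omega)).symm).br_right _ this).congr (one_mul _)

/-- On two nodes this is the Serre relation; the generators appended afterwards commute with e_a. -/
theorem e_qComm_seg_left (h : a ≠ M) (hb : b = a + 1) :
    QComm (qi q M b)⁻¹ (D.e ε a) (D.seg ε a (k + 1)) := by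
  subst hb
  induction k with
  | zero => exact (D.serre_qi (a + 1) h (Or.inl rfl)).qComm_left (D.qi_ne _)
  | succ k ih =>
    rw [D.seg_succ (b := a + k + 2) (by omega)]
    exact (ih.br_right _ (QComm.of_commute (D.comm _ _ _ (by omega)))).congr (mul_one _)

theorem seg_qComm_e_right_aux {c : ℂ} (hb : b = a + k + 1)
    (h : QComm c (br (qi q M b) (D.e ε (b - 1)) (D.e ε b)) (D.e ε b)) :
    QComm c (D.seg ε a (k + 1)) (D.e ε b) := by
  induction k generalizing a with
  | zero =>
    rw [D.seg_succ (b := b) (by omega), seg_zero]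
    convert h using 3
    omega
  | succ k ih =>
    rw [D.seg_succ_left (b := a + 1) rfl]
    exact ((QComm.of_commute (D.comm _ _ _ (by omega))).br_left _
      (ih (a := a + 1) (by omega))).congr (one_mul _)

theorem seg_qComm_e_right (hb : b = a + k + 1) (h : b ≠ M) :
    QComm (qi q M b)⁻¹ (D.seg ε a (k + 1)) (D.e ε b) :=
  D.seg_qComm_e_right_aux hb
    ((D.serre_qi b h (Or.inr (by omega))).qComm_right (D.qi_ne _))

/-- At the odd node e_M² = 0 replaces the Serre relation: with x = e_{M-1}, both products of [x,
e_M]_q with e_M are multiples of e_M x e_M. -/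
theorem seg_qComm_e_right_odd (hb : M = a + k + 1) :
    QComm (-q) (D.seg ε a (k + 1)) (D.e ε M) := by
  apply D.seg_qComm_e_right_aux hb
  have h := D.sq ε
  have h' : ∀ w, D.e ε M * (D.e ε M * w) = 0 := fun w => by rw [← mul_assoc, h, zero_mul]
  rw [qi_of_le le_rfl, QComm]
  simp only [br, sub_mul, mul_sub, smul_mul_assoc, mul_smul_comm, mul_assoc, h, h', mul_zero]
  module

theorem seg_sq_aux : D.seg ε M k * D.seg ε M k = 0 := by
  induction k with
  | zero => exact D.sq ε
  | succ k ih =>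
    rw [D.seg_succ (b := M + k + 1) rfl]
    apply sq_br_right (D.qi_sq_add_one_ne _) (D.qi_ne _) ih
    rw [← D.seg_succ (b := M + k + 1) rfl]
    exact D.seg_qComm_e_right rfl (by omega)

/-- The interval grows from the node M, first to the right and then to the left; every node added is
even, and adding it preserves nilpotency. -/
theorem seg_sq (h1 : a ≤ M) (h2 : M ≤ a + k) : D.seg ε a k * D.seg ε a k = 0 := by
  obtain ⟨d, hd⟩ : ∃ d, M = a + d := ⟨M - a, by omega⟩
  induction d generalizing a k with
  | zero => obtain rfl : a = M := by omega
            exact D.seg_sq_aux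
  | succ d ih =>
    obtain ⟨k, rfl⟩ : ∃ m, k = m + 1 := ⟨k - 1, by omega⟩
    rw [D.seg_succ_left (b := a + 1) rfl]
    apply sq_br_left (D.qi_sq_add_one_ne _) (D.qi_ne _) (ih (by omega) (by omega) (by omega))
    rw [← D.seg_succ_left (b := a + 1) rfl]
    exact D.e_qComm_seg_left (by omega) rfl

/-! ### Commutation among root vectors of opposite signs -/

theorem cross_K : br (sg M j) (D.e ε j) (D.e (-ε) j) =
    ((if ε = 1 then 1 else sg M j) * (qi q M j - (qi q M j)⁻¹)⁻¹) • (D.K ε j - D.K (-ε) j) :=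
  D.cross_same ε j

theorem units_mul_neg (ε : ℤˣ) : (ε : ℤ) * ((-ε : ℤˣ) : ℤ) = -1 := by
  rcases Int.units_eq_one_or ε with rfl | rfl <;> rfl

theorem units_neg_mul (ε : ℤˣ) : ((-ε : ℤˣ) : ℤ) * (ε : ℤ) = -1 := by
  rcases Int.units_eq_one_or ε with rfl | rfl <;> rfl

theorem units_mul_self (ε : ℤˣ) : (ε : ℤ) * (ε : ℤ) = 1 := by
  rcases Int.units_eq_one_or ε with rfl | rfl <;> rfl

theorem qi_factor (D : GlRep q M n A) (j : ℕ) (τ : ℂ) :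
    τ * (qi q M j - (qi q M j)⁻¹)⁻¹ * (1 - qi q M j ^ 2) = -(τ * qi q M j) := by
  have h := D.qi_sub_inv_ne j
  have h' := D.qi_ne j
  have : 1 - qi q M j ^ 2 = -(qi q M j) * (qi q M j - (qi q M j)⁻¹) := by field_simp; ring
  rw [this]
  generalize qi q M j - (qi q M j)⁻¹ = x at *
  field_simp

/-- Only the last generator of the root vector fails to commute with e_b^ε, so the bracket replaces
it by a Cartan element. -/
theorem cross_seg_right (hb : b = a + k + 1) :
    br (sg M b) (D.e ε b) (D.seg (-ε) a (k + 1)) =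
      (-((if ε = 1 then 1 else sg M b) * qi q M b)) • (D.seg (-ε) a k * D.K ε b) := by
  rw [D.seg_succ hb, br_cross_right (D.e_cross_comm_seg (Or.inr (by omega))) D.cross_K (D.qi_ne b),
    D.qi_factor]
  · apply D.K_seg
    rw [units_mul_neg]
    simp only [kWeight, ind, l_coe]
    split_ifs <;> omega
  · rw [qi, ← zpow_neg]
    apply D.K_seg
    rw [units_mul_self]
    simp only [kWeight, ind, l_coe]
    split_ifs <;> omega

theorem cross_seg_left (ha : a < M) :
    br 1 (D.e ε a) (D.seg (-ε) a (k + 1)) = D.seg (-ε) (a + 1) k * D.K (-ε) a := by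
  have hs : sg M a = 1 := if_neg (by omega)
  have hq := D.q_sub_inv_ne
  have h := D.cross_K (ε := ε) (j := a)
  rw [hs, ite_self, one_mul, qi_of_le ha.le] at h
  rw [D.seg_succ_left (b := a + 1) rfl, qi_of_le (by omega : a + 1 ≤ M),
    br_cross_left (D.e_cross_comm_seg (Or.inl (by omega))) h D.q_ne, inv_mul_cancel₀ hq, one_smul]
  · refine (D.K_seg _ _ _ _ _ 1 ?_).congr (zpow_one q)
    rw [units_mul_neg]
    simp only [kWeight, ind, l_coe]
    split_ifs <;> omega
  · refine (D.K_seg _ _ _ _ _ (-1) ?_).congr (zpow_neg_one q)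
    rw [units_mul_self]
    simp only [kWeight, ind, l_coe]
    split_ifs <;> omega

/-- Cut after the node j: the bracket with e_j leaves the shorter root vector times K_j. By weight
this q-commutes with the generator at j + 1 with just the parameter of the next bracket, which
therefore vanishes. -/
theorem e_cross_qComm_seg_inner (h1 : a < j) (h2 : j < a + k) :
    QComm (sg M j) (D.e ε j) (D.seg (-ε) a k) := by
  obtain ⟨d, rfl⟩ : ∃ d, k = (j - a) + d + 1 := ⟨k - (j - a) - 1, by omega⟩
  induction d with
  | zero =>
    obtain ⟨m, rfl⟩ : ∃ m, j = a + m + 1 := ⟨j - a - 1, by omega⟩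
    rw [show a + m + 1 - a + 0 + 1 = m + 1 + 1 by omega, D.seg_succ (b := a + m + 2) (by omega)]
    apply br_cross_inner (D.cross _ _ _ (by omega))
    rw [D.cross_seg_right rfl]
    refine ((QComm.mul_left (c := 1) (QComm.of_commute ?_) ?_).congr (one_mul _)).smul_left _
    · exact (D.e_comm_seg (Or.inr (by omega))).symm
    · apply D.K_seg (k := 0)
      rw [units_mul_neg]
      simp only [kWeight, ind, l_coe]
      split_ifs <;> omega
  | succ d ih =>
    rw [show j - a + (d + 1) + 1 = j - a + d + 1 + 1 by omega,
      D.seg_succ (b := j + d + 2) (by omega)]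
    exact ((ih (by omega)).br_right _ (QComm.of_commute (D.cross _ _ _ (by omega)))).congr
      (mul_one _)

/-- The bracket of the two root vectors of weight `±(ε_1 - ε_{k+2})`. -/
theorem br_seg_seg (k : ℕ) (hk : k + 2 ≤ n) :
    br (if M ≤ k + 1 then -1 else 1) (D.seg 1 1 k) (D.seg (-1) 1 k) =
      ((∏ j ∈ Finset.range k, -qi q M (j + 2)) * (q - q⁻¹)⁻¹) •
        (D.t 1 1 * D.t (-l M (k + 2)) (k + 2) - D.t (-1) 1 * D.t (l M (k + 2)) (k + 2)) := by
  have hM := D.one_lt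
  induction k with
  | zero =>
    have h := D.cross_K (ε := 1) (j := 1)
    have hl : l M 1 = 1 := if_pos hM.le
    rw [show sg M 1 = 1 from if_neg (by omega), if_pos rfl, qi_of_le hM.le] at h
    rw [if_neg (by omega)]
    simpa [K, seg, hl] using h
  | succ k ih =>
    have ih := ih (by omega)
    -- The root vector on the nodes 1, …, k + 1 is odd exactly when M ≤ k + 1; the sign changes when
    -- the node M is added.
    have hs : (if M ≤ k + 1 + 1 then (-1 : ℂ) else 1) =
        (if M ≤ k + 1 then -1 else 1) * sg M (k + 2) := by
      unfold sg
      split_ifs <;> first | omega | norm_num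
    have h := D.cross_K (ε := 1) (j := k + 2)
    rw [if_pos rfl, one_mul] at h
    have hb : k + 2 = 1 + k + 1 := by omega
    have c1 : ∀ ε δ i j, Commute (D.t ε i) (D.t δ j) := D.t_comm
    rw [hs, D.seg_succ hb, D.seg_succ hb, br_br_cross (D.qi_ne _) (D.qi_sub_inv_ne _) ?_
      (D.e_cross_comm_seg (Or.inr (by omega))) h ih]
    · rw [Finset.prod_range_succ, K, K]
      have e1 := D.t_inv (l M (k + 2)) (k + 2) (by omega) (by omega)
      have e2 := D.t_inv (-l M (k + 2)) (k + 2) (by omega) (by omega)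
      rw [neg_neg] at e2
      have e3 : ∀ (x y z w : A), z * w = 1 → x * z * (w * y) = x * y := by
        intro x y z w h
        rw [mul_assoc, ← mul_assoc z, h, one_mul]
      simp only [one_mul, neg_mul, neg_neg]
      rw [e3 _ _ _ _ e1, e3 _ _ _ _ e2]
      module
    · apply D.K_seg
      simp only [kWeight, ind, l_coe, Units.val_neg, Units.val_one]
      split_ifs <;> omega
    · rw [qi, ← zpow_neg]
      apply D.K_seg
      simp only [kWeight, ind, l_coe, Units.val_neg, Units.val_one]
      split_ifs <;> omega
    · rw [qi, ← zpow_neg]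
      apply D.K_seg
      simp only [kWeight, ind, l_coe, Units.val_one]
      split_ifs <;> omega
    · apply D.t_t_seg (k := 0)
      simp only [ind, l_coe, Units.val_neg, Units.val_one]
      split_ifs <;> omega
    · rw [qi, ← zpow_neg]
      apply D.t_t_seg (k := 0)
      simp only [ind, l_coe, Units.val_neg, Units.val_one]
      split_ifs <;> omega
    · apply D.t_t_seg (k := 0)
      simp only [ind, l_coe, Units.val_neg, Units.val_one]
      split_ifs <;> omega
    · exact ((c1 _ _ _ _).mul_right (c1 _ _ _ _)).mul_left ((c1 _ _ _ _).mul_right (c1 _ _ _ _))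
    · exact ((c1 _ _ _ _).mul_right (c1 _ _ _ _)).mul_left ((c1 _ _ _ _).mul_right (c1 _ _ _ _))
    · apply QComm.commute
      apply QComm.congr _ (inv_one)
      apply QComm.symm one_ne_zero
      apply QComm.of_commute
      simpa using D.e_cross_comm_seg (ε := -1) (a := 1) (k := k) (j := k + 2) (Or.inr (by omega))

end GlRep

/-! ### The affine root vector and its relations -/

namespace GlRep

variable {q : ℂ} {M n : ℕ} {A : Type*} [Ring A] [Algebra ℂ A] (D : GlRep q M n A)
variable {ε δ : ℤˣ} {a b j k : ℕ}

/-- The image of `E_0^ε` up to a scalar. -/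
def z (ε : ℤˣ) : A := D.seg (-ε) 1 (n - 2) * D.T ε

theorem sg_inv (M j : ℕ) : (sg M j)⁻¹ = sg M j :=
  inv_eq_of_mul_eq_one_left (sg_mul_self M j)

theorem sg_ne_zero (M j : ℕ) : sg M j ≠ 0 := left_ne_zero_of_mul_eq_one (sg_mul_self M j)

theorem QComm_sg_symm {x y : A} (h : QComm (sg M j) x y) : QComm (sg M j) y x :=
  (h.symm (sg_ne_zero M j)).congr (sg_inv M j)

theorem T_e_edge (h : j = 1 ∨ j + 1 = n) : QComm q (D.T ε) (D.e ε j) := by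
  have h1 := D.one_lt
  have h2 := D.lt
  refine (D.T_seg ε ε j 0 1 ?_).congr (zpow_one q)
  rw [units_mul_self]
  simp only [topWeight, ind]
  split_ifs <;> omega

theorem T_e_edge_neg (h : j = 1 ∨ j + 1 = n) : QComm q⁻¹ (D.T ε) (D.e (-ε) j) := by
  have h1 := D.one_lt
  have h2 := D.lt
  refine (D.T_seg ε (-ε) j 0 (-1) ?_).congr (zpow_neg_one q)
  rw [units_mul_neg]
  simp only [topWeight, ind]
  split_ifs <;> omega

theorem T_seg_inner (h1 : 1 < a) (h2 : a + k + 1 < n) :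
    QComm 1 (D.T δ) (D.seg ε a k) := by
  refine (D.T_seg δ ε a k 0 ?_).congr (zpow_zero q)
  simp only [topWeight, ind]
  rw [if_neg, if_neg, if_neg, if_neg] <;> omega

/-- The root vector inside z^ε has the sign of e_j^{-ε}. At the two end nodes it contributes a
factor q, cancelled by the factor q⁻¹ from t_1 t_n⁻¹; at interior nodes the torus factor commutes.
-/
theorem z_cross (h1 : 1 ≤ j) (h2 : j < n) : QComm (sg M j) (D.z ε) (D.e (-ε) j) := by
  have hM := D.one_lt
  have hn := D.lt
  have hq := D.q_ne
  obtain ⟨k, rfl⟩ : ∃ k, n = k + 3 := ⟨n - 3, by omega⟩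
  rcases eq_or_lt_of_le h1 with rfl | h1
  · refine (QComm.mul_left ((D.e_qComm_seg_left (by omega) rfl).symm (inv_ne_zero (D.qi_ne _)))
      (D.T_e_edge_neg (Or.inl rfl))).congr ?_
    rw [qi_of_le (by omega), inv_inv, mul_inv_cancel₀ hq, sg, if_neg (by omega)]
  · rcases eq_or_lt_of_le (show j + 1 ≤ k + 3 by omega) with h | h
    · have hT := D.T_e_edge_neg (ε := ε) (Or.inr h)
      by_cases hj : j = M
      · subst hj
        refine (QComm.mul_left (D.seg_qComm_e_right_odd (k := k) (by omega)) hT).congr ?_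
        rw [neg_mul, mul_inv_cancel₀ hq, sg, if_pos rfl]
      · refine (QComm.mul_left (D.seg_qComm_e_right (k := k) (by omega) hj) hT).congr ?_
        rw [qi_of_lt (by omega), inv_inv, mul_inv_cancel₀ hq, sg, if_neg hj]
    · refine (QComm.mul_left
        (QComm_sg_symm (D.e_qComm_seg_inner (a := 1) (k := k + 1) (by omega) (by omega)))
        (D.T_seg_inner (a := j) (k := 0) (by omega) (by omega))).congr (mul_one _)

theorem z_qComm_e (h1 : 1 < j) (h2 : j + 1 < n) : QComm (sg M j) (D.z ε) (D.e ε j) :=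
  (QComm.mul_left (QComm_sg_symm (D.e_cross_qComm_seg_inner (by omega) (by omega)))
    (D.T_seg_inner (a := j) (k := 0) (by omega) (by omega))).congr (mul_one _)

theorem T_top : QComm (q ^ (-2 : ℤ)) (D.T ε) (D.seg (-ε) 1 (n - 2)) := by
  have hM := D.one_lt
  have hn := D.lt
  apply D.T_seg
  rw [units_mul_neg]
  simp only [topWeight, ind]
  split_ifs <;> omega

theorem z_sq : D.z ε * D.z ε = 0 := by
  have hM := D.one_lt
  have hn := D.lt
  have h : QComm _ _ _ := D.T_top (ε := ε)
  rw [z, mul_assoc, h.assoc, mul_smul_comm, ← mul_assoc, D.seg_sq (by omega) (by omega), zero_mul,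
    smul_zero]

/-- Moving T past e yields the q that turns the q⁻¹-bracket into an ordinary commutator, to which
stripping of an end node applies. -/
theorem br_inv_mul {T x e : A} (hq : q ≠ 0) (h : QComm q T e) :
    br q⁻¹ e (x * T) = br 1 e x * T := by
  simp only [br, sub_mul, smul_mul_assoc, mul_assoc, h.eq, mul_smul_comm, smul_smul,
    inv_mul_cancel₀ hq]

/-- `[e_1^ε, z^ε]_{q⁻¹}`. -/
theorem br_e_one_z :
    br q⁻¹ (D.e ε 1) (D.z ε) = D.seg (-ε) 2 (n - 3) * D.K (-ε) 1 * D.T ε := by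
  have hM := D.one_lt
  have hn := D.lt
  obtain ⟨k, rfl⟩ : ∃ k, n = k + 3 := ⟨n - 3, by omega⟩
  have h : QComm _ _ _ := D.T_e_edge (ε := ε) (j := 1) (Or.inl rfl)
  rw [z, br_inv_mul D.q_ne h]
  exact congrArg (· * _) (D.cross_seg_left (k := k) hM)

/-- The inner bracket equals Z T, which commutes with e up to q⁻² · q = q⁻¹, so the outer q-bracket
vanishes. -/
theorem serre_of_br {e x Z T : A} (hq : q ≠ 0) (h : QComm q T e) (hx : br 1 e x = Z)
    (hZ : QComm (q ^ (-2 : ℤ)) Z e) : Serre q e (x * T) := by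
  unfold Serre
  have h2 := hZ.mul_left h
  rw [← br_br_self hq, br_inv_mul hq h, hx, br, h2.eq, smul_smul, zpow_neg, zpow_ofNat]
  match_scalars
  field_simp
  ring

theorem serre_z (hj : j = 1 ∨ j + 1 = n) (hjM : j ≠ M) : Serre q (D.e ε j) (D.z ε) := by
  have hM := D.one_lt
  have hn := D.lt
  have hT := D.T_e_edge (ε := ε) hj
  obtain ⟨k, rfl⟩ : ∃ k, n = k + 3 := ⟨n - 3, by omega⟩
  rcases hj with rfl | hj
  · apply serre_of_br D.q_ne hT (D.cross_seg_left (k := k) hM)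
    refine (QComm.mul_left (QComm.of_commute ?_) (D.K_seg _ ε 1 1 0 (-2) ?_)).congr (one_mul _)
    · exact (D.e_cross_comm_seg (Or.inl (by omega))).symm
    · rw [units_neg_mul]
      simp only [kWeight, ind, l_coe]
      split_ifs <;> omega
  · obtain rfl : j = k + 2 := by omega
    have h := D.cross_seg_right (ε := ε) (a := 1) (k := k) (b := k + 2) (by omega)
    rw [sg, if_neg hjM] at h
    apply serre_of_br D.q_ne hT h
    refine ((QComm.mul_left (QComm.of_commute ?_) (D.K_seg _ ε _ _ 0 (-2) ?_)).congr
      (one_mul _)).smul_left _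
    · exact (D.e_cross_comm_seg (Or.inr (by omega))).symm
    · rw [units_mul_self]
      simp only [kWeight, ind, l_coe]
      split_ifs <;> omega

/-- All nodes of the shorter vector are interior to the longer one; the signs multiply to -1 exactly
when the node M is among them. -/
theorem seg_qComm_seg (hk : k + 3 < n) :
    QComm (if M ≤ k + 2 then -1 else 1) (D.seg ε 2 k) (D.seg ε 1 (n - 2)) := by
  have hM := D.one_lt
  induction k with
  | zero =>
    refine (D.e_qComm_seg_inner (by omega) (by omega)).congr ?_
    unfold sg
    split_ifs <;> first | omega | rfl
  | succ k ih =>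
    rw [D.seg_succ (b := k + 3) (by omega)]
    refine ((ih (by omega)).br_left _ (D.e_qComm_seg_inner (by omega) (by omega))).congr ?_
    unfold sg
    split_ifs <;> first | omega | norm_num

/-- The quartic relation at the affine node. -/
theorem quartic_zero (h3 : 3 < n) :
    QComm (-sg M (n - 1)) (br (sg M (n - 1) * q) (br q⁻¹ (D.e ε 1) (D.z ε)) (D.e ε (n - 1)))
      (D.z ε) := by
  have hM := D.one_lt
  have hn := D.lt
  have hc := D.seg_qComm_seg (ε := -ε) (k := n - 4) (by omega)
  -- The nodes 2, …, n - 2 that survive the stripping include M unless M = n - 1.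
  have hs : (if M ≤ n - 4 + 2 then (-1 : ℂ) else 1) = -sg M (n - 1) := by
    unfold sg
    split_ifs <;> first | omega | norm_num
  rw [hs] at hc
  obtain ⟨k, rfl⟩ : ∃ k, n = k + 4 := ⟨n - 4, by omega⟩
  rw [br_e_one_z]
  change QComm _ (br (sg M (k + 3) * q) (D.seg (-ε) 2 (k + 1) * _ * _) (D.e ε (k + 3)))
    (D.seg (-ε) 1 (k + 2) * _)
  change QComm (-sg M (k + 3)) (D.seg (-ε) 2 k) (D.seg (-ε) 1 (k + 2)) at hc
  have h := D.cross_seg_right (ε := ε) (a := 2) (k := k) (b := k + 3) (by omega)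
  have hT := D.T_e_edge (ε := ε) (j := k + 3) (Or.inr rfl)
  have hK : QComm 1 (D.K (-ε) 1) (D.e ε (k + 3)) := by
    refine (D.K_seg _ ε _ _ 0 0 ?_).congr (zpow_zero q)
    rw [units_neg_mul]
    simp only [kWeight, ind, l_coe]
    split_ifs <;> omega
  have hKT : QComm (1 * q) (D.K (-ε) 1 * D.T ε) (D.e ε (k + 3)) := hK.mul_left hT
  have e1 : br (sg M (k + 3) * q) (D.seg (-ε) 2 (k + 1) * D.K (-ε) 1 * D.T ε) (D.e ε (k + 3)) =
      (-(sg M (k + 3) * q)) • (br (sg M (k + 3)) (D.e ε (k + 3)) (D.seg (-ε) 2 (k + 1)) *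
        (D.K (-ε) 1 * D.T ε)) := by
    have := sg_mul_self M (k + 3)
    simp only [br, mul_assoc, hKT.eq, sub_mul, smul_sub, mul_smul_comm, smul_mul_assoc, smul_smul]
    match_scalars
    · linear_combination (-q) * this
    · ring
  rw [e1, h, smul_mul_assoc]
  apply QComm.smul_left
  apply QComm.smul_left
  -- The two Cartan elements contribute q each, and T contributes q⁻².
  have hG : QComm 1 (D.K ε (k + 3) * (D.K (-ε) 1 * D.T ε)) (D.seg (-ε) 1 (k + 2)) := by
    refine (QComm.mul_left (D.K_seg _ _ _ _ _ 1 ?_) (QComm.mul_left (D.K_seg _ _ _ _ _ 1 ?_)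
      D.T_top)).congr ?_
    · rw [units_mul_neg]
      simp only [kWeight, ind, l_coe]
      split_ifs <;> omega
    · rw [units_mul_self]
      simp only [kWeight, ind, l_coe]
      split_ifs <;> omega
    · rw [← zpow_add₀ D.q_ne, ← zpow_add₀ D.q_ne]
      exact zpow_zero q
  have hGT : QComm 1 (D.K ε (k + 3) * (D.K (-ε) 1 * D.T ε)) (D.T ε) := by
    apply QComm.of_commute
    have h1 : Commute (D.K ε (k + 3)) (D.T ε) := D.K_T_comm _ _ _
    have h2 : Commute (D.K (-ε) 1) (D.T ε) := D.K_T_comm _ _ _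
    exact h1.mul_left (h2.mul_left (Commute.refl _))
  have hcT : QComm 1⁻¹ (D.seg (-ε) 2 k) (D.T ε) :=
    (D.T_seg_inner (by omega) (by omega)).symm one_ne_zero
  rw [mul_assoc]
  refine (QComm.mul_left (hc.mul_right hcT) (hG.mul_right hGT)).congr ?_
  rw [inv_one, mul_one, mul_one, mul_one]
  rfl

/-- The quartic relation at the node `M`, when the next node is not affine. -/
theorem quartic_M (ε : ℤˣ) :
    br (-1) (br q (br q⁻¹ (D.e ε (M - 1)) (D.e ε M)) (D.e ε (M + 1))) (D.e ε M) = 0 := by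
  have hM := D.one_lt
  have h := quartic_symm (a := q⁻¹) (b := q) (s := 1) (mul_one 1) (D.sq ε)
    (D.comm ε (M - 1) (M + 1) (by omega))
  rw [one_mul, one_mul] at h
  rw [h, br_eq_zero_iff]
  exact ((D.quartic ε).symm (by norm_num)).congr (by norm_num)

/-- The quartic relation at the node `M`, when the next node is affine. -/
theorem quartic_M_affine (ε : ℤˣ) (hn : M + 1 = n) (h3 : 3 < n) :
    br 1 (br (-q) (br q⁻¹ (D.e ε (M - 1)) (D.e ε M)) (D.z ε)) (D.e ε M) = 0 := by
  subst hn
  have hq := D.q_ne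
  -- Here n > 3 matters: it makes M - 1 an interior node.
  have hxz : D.e ε (M - 1) * D.z ε = D.z ε * D.e ε (M - 1) := by
    have := D.z_qComm_e (ε := ε) (j := M - 1) (by omega) (by omega)
    rw [sg, if_neg (by omega)] at this
    exact this.commute.symm
  have h := quartic_symm (a := q⁻¹) (b := q) (s := -1) (by norm_num) (D.sq ε) hxz
  rw [neg_neg, neg_one_mul, neg_one_mul] at h
  -- With the parameters exchanged, regrouping puts [e_M, z] innermost, so that the nodes M and M -
  -- 1 are stripped in turn from the right end.
  rw [h, br_br_of_commute _ _ hxz]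
  obtain ⟨k, rfl⟩ : ∃ k, M = k + 3 := ⟨M - 3, by omega⟩
  have hT : QComm _ _ _ := D.T_e_edge (ε := ε) (j := k + 3) (Or.inr rfl)
  have e1 : br (-q⁻¹) (D.e ε (k + 3)) (D.z ε) =
      br (-1) (D.e ε (k + 3)) (D.seg (-ε) 1 (k + 2)) * D.T ε := by
    simp only [z, br, mul_assoc, hT.eq, sub_mul, mul_smul_comm, smul_mul_assoc, smul_smul]
    rw [neg_mul, inv_mul_cancel₀ hq]
    rfl
  have h1 := D.cross_seg_right (ε := ε) (a := 1) (k := k + 1) (b := k + 3) (by omega)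
  have h2 := D.cross_seg_right (ε := ε) (a := 1) (k := k) (b := k + 2) (by omega)
  rw [sg, if_pos rfl] at h1
  rw [sg, if_neg (by omega)] at h2
  rw [e1, h1]
  have hK : QComm q⁻¹ (D.K ε (k + 3) * D.T ε) (D.e ε (k + 2)) := by
    refine (QComm.mul_left (D.K_seg _ _ _ _ 0 (-1) ?_) (D.T_seg_inner (k := 0) (by omega)
      (by omega))).congr ((mul_one _).trans (zpow_neg_one q))
    rw [units_mul_self]
    simp only [kWeight, ind, l_coe]
    split_ifs <;> omega
  change br 1 (br q (D.e ε (k + 2)) _) _ = 0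
  generalize -((if ε = 1 then (1 : ℂ) else -1) * qi q (k + 3) (k + 3)) = α
  have e2 : br q (D.e ε (k + 2)) (α • (D.seg (-ε) 1 (k + 1) * D.K ε (k + 3)) * D.T ε) =
      α • (br 1 (D.e ε (k + 2)) (D.seg (-ε) 1 (k + 1)) * (D.K ε (k + 3) * D.T ε)) := by
    simp only [br, mul_assoc, hK.eq, sub_mul, smul_sub, mul_smul_comm, smul_mul_assoc, smul_smul]
    match_scalars <;> field_simp
  rw [e2, h2, br_eq_zero_iff, smul_mul_assoc]
  refine QComm.smul_left _ (QComm.smul_left _ ?_)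
  refine (QComm.mul_left (QComm.mul_left (QComm.of_commute
    (D.e_cross_comm_seg (Or.inr (by omega))).symm) (D.K_seg _ _ _ _ 0 (-1) ?_))
    (QComm.mul_left (D.K_seg _ _ _ _ 0 0 ?_) hT)).congr ?_
  · rw [units_mul_self]
    simp only [kWeight, ind, l_coe]
    split_ifs <;> omega
  · rw [units_mul_self]
    simp only [kWeight, ind, l_coe]
    split_ifs <;> omega
  · rw [zpow_neg_one, zpow_zero]
    field_simp

end GlRep

/-! ### The quintic relation -/

namespace GlRep

variable {q : ℂ} {M n : ℕ} {A : Type*} [Ring A] [Algebra ℂ A]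

set_option maxHeartbeats 4000000 in
/-- The quintic relation for `(M, N) = (2, 1)`. -/
theorem quintic (D : GlRep q 2 3 A) (ε : ℤˣ) :
    br (-q⁻¹) (D.z ε) (br 1 (D.e ε 2) (br (-1) (D.z ε) (br q (D.e ε 2) (D.e ε 1)))) =
      br (-q⁻¹) (D.e ε 2) (br 1 (D.z ε) (br (-1) (D.e ε 2) (br q (D.z ε) (D.e ε 1)))) := by
  have hq := D.q_ne
  have hz : D.z ε = D.seg (-ε) 1 1 * D.T ε := rfl
  have x1 : br 1 (D.e ε 1) (D.seg (-ε) 1 1) = D.e (-ε) 2 * D.K (-ε) 1 :=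
    D.cross_seg_left (k := 0) (by omega)
  have x2 := D.cross_seg_right (ε := ε) (a := 1) (k := 0) (b := 2) rfl
  have k1 := D.cross_K (ε := ε) (j := 1)
  have k2 := D.cross_K (ε := ε) (j := 2)
  have xf2 := D.seg_qComm_e_right_odd (ε := -ε) (a := 1) (k := 0) rfl
  have xf1 := (D.e_qComm_seg_left (ε := -ε) (a := 1) (b := 2) (k := 0) (by omega) rfl).symm
    (inv_ne_zero (D.qi_ne 2))
  rw [inv_inv, qi_of_le le_rfl, zero_add] at xf1
  have xx := D.seg_sq (ε := -ε) (a := 1) (k := 1) (by omega) (by omega)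
  have f12 : D.seg (-ε) 1 1 = br q (D.e (-ε) 1) (D.e (-ε) 2) := by
    rw [D.seg_succ (b := 2) rfl, qi_of_le le_rfl]; rfl
  have e22 := D.sq ε
  have f1e2 := D.cross ε 2 1 (by omega)
  have wt : ∀ (δ ε : ℤˣ) (i a : ℕ) (m : ℤ), (δ : ℤ) * ε * kWeight 2 i a (a + 1) = m →
    QComm (q ^ m) (D.K δ i) (D.e ε a) := fun δ ε i a m h => D.K_seg δ ε i a 0 m h
  have Te1 : QComm _ _ _ := D.T_e_edge (ε := ε) (j := 1) (Or.inl rfl)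
  have Te2 : QComm _ _ _ := D.T_e_edge (ε := ε) (j := 2) (Or.inr rfl)
  have Tf1 : QComm _ _ _ := D.T_e_edge_neg (ε := ε) (j := 1) (Or.inl rfl)
  have Tf2 : QComm _ _ _ := D.T_e_edge_neg (ε := ε) (j := 2) (Or.inr rfl)
  have TX : QComm _ _ (D.seg (-ε) 1 1) := D.T_top (ε := ε)
  have w1 : kWeight 2 1 1 2 = 2 := by simp [kWeight, ind, l_coe]
  have w2 : kWeight 2 1 2 3 = -1 := by simp [kWeight, ind, l_coe]
  have w3 : kWeight 2 2 1 2 = -1 := by simp [kWeight, ind, l_coe]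
  have w4 : kWeight 2 2 2 3 = 0 := by simp [kWeight, ind, l_coe]
  have p1 := units_mul_self ε
  have p2 := units_mul_neg ε
  have p3 := units_neg_mul ε
  have p4 := units_mul_self (-ε)
  have a2 : QComm _ _ _ := wt (-ε) ε 1 2 1 (by rw [p3, w2]; rfl)
  have a3 : QComm _ _ _ := wt (-ε) (-ε) 1 1 2 (by rw [p4, w1]; rfl)
  have a4 : QComm _ _ _ := wt (-ε) (-ε) 1 2 (-1) (by rw [p4, w2]; rfl)
  have b2 : QComm _ _ _ := wt ε ε 1 2 (-1) (by rw [p1, w2]; rfl)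
  have b3 : QComm _ _ _ := wt ε (-ε) 1 1 (-2) (by rw [p2, w1]; rfl)
  have b4 : QComm _ _ _ := wt ε (-ε) 1 2 1 (by rw [p2, w2]; rfl)
  have c2 : QComm _ _ _ := wt (-ε) ε 2 2 0 (by rw [p3, w4]; rfl)
  have c3 : QComm _ _ _ := wt (-ε) (-ε) 2 1 (-1) (by rw [p4, w3]; rfl)
  have c4 : QComm _ _ _ := wt (-ε) (-ε) 2 2 0 (by rw [p4, w4]; rfl)
  have d1 : QComm _ _ _ := wt ε ε 2 1 (-1) (by rw [p1, w3]; rfl)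
  have d2 : QComm _ _ _ := wt ε ε 2 2 0 (by rw [p1, w4]; rfl)
  have d3 : QComm _ _ _ := wt ε (-ε) 2 1 1 (by rw [p2, w3]; rfl)
  have d4 : QComm _ _ _ := wt ε (-ε) 2 2 0 (by rw [p2, w4]; rfl)
  have aX := a3.br_right q a4
  have bX := b3.br_right q b4
  have cX := c3.br_right q c4
  have dX := d3.br_right q d4
  have t1 := D.K_T_comm 1 (-ε) ε
  have t2 := D.K_T_comm 1 ε ε
  have t3 := D.K_T_comm 2 (-ε) ε
  have t4 := D.K_T_comm 2 ε ε
  have t5 := D.K_comm 2 1 ε (-ε)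
  have t6 := D.K_comm 2 1 ε ε
  have t7 := D.K_comm 2 1 (-ε) (-ε)
  have t9 := D.K_comm 2 2 (-ε) ε
  rw [← f12] at aX bX cX dX
  rw [qi_of_le (by omega : 1 ≤ 2)] at k1
  rw [qi_of_le le_rfl] at k2 x2
  rw [seg_zero] at x2
  rw [show sg 2 1 = 1 from rfl] at k1
  rw [show sg 2 2 = -1 from rfl] at k2 x2
  rw [hz]
  generalize (if ε = 1 then (1 : ℂ) else -1) = τ at *
  rw [ite_self, one_mul] at k1
  obtain ⟨h, hh⟩ : ∃ h, h = (q - q⁻¹)⁻¹ := ⟨_, rfl⟩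
  have hq2 : q ^ 2 - 1 ≠ 0 := sub_ne_zero.2 D.sq_ne_one
  have hh' : h = q / (q ^ 2 - 1) := by
    rw [hh]
    field_simp
  rw [← hh] at k1 k2
  clear hh
  generalize D.seg (-ε) 1 1 = X at *
  generalize D.T ε = T at *
  generalize D.K ε 1 = K₁ at *
  generalize D.K (-ε) 1 = K₁' at *
  generalize D.K ε 2 = K₂ at *
  generalize D.K (-ε) 2 = K₂' at *
  generalize D.e ε 1 = e₁ at *
  generalize D.e ε 2 = e₂ at *
  generalize D.e (-ε) 1 = f₁ at *
  generalize D.e (-ε) 2 = f₂ at *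
  clear hz wt
  have x1' : X * e₁ = e₁ * X - f₂ * K₁' := by rw [← x1, br]; module
  have x2' : X * e₂ = -(e₂ * X) - (τ * q) • (f₁ * K₂) := by
    rw [← sub_eq_zero]; rw [br, ← sub_eq_zero] at x2; rw [← x2]; module
  have k1' : f₁ * e₁ = e₁ * f₁ - h • (K₁ - K₁') := by rw [← k1, br]; module
  have k2' : f₂ * e₂ = -(e₂ * f₂) + (τ * h) • (K₂ - K₂') := by rw [← k2, br]; module
  have f12' : f₁ * f₂ = X + q • (f₂ * f₁) := by rw [f12, br]; module
  clear x1 x2 k1 k2 f12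
  have assoc : ∀ {x y : A} {r : A}, x * y = r → ∀ w, x * (y * w) = r * w := fun h w => by
    rw [← mul_assoc, h]
  -- Both sides are put in triangular normal order: words in e₁ and e₂, then f₂, f₁, X, then T and
  -- the Cartan elements. Coefficients can then be compared.
  simp only [br, mul_sub, sub_mul, mul_add, add_mul, mul_neg, neg_mul, smul_sub, smul_add,
    smul_neg, mul_smul_comm, smul_mul_assoc, mul_assoc, smul_smul, assoc xx, assoc e22, zero_mul,
    mul_zero, smul_zero, xf1.assoc, xf2.assoc, assoc x1', assoc x2', assoc k1', assoc k2',
    assoc f12', assoc f1e2.symm, Te1.eq, Te2.eq, Te1.assoc, Te2.assoc, Tf1.assoc, Tf2.assoc,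
    TX.assoc, a2.eq, a2.assoc, a3.assoc, aX.assoc, b2.assoc, b3.assoc, bX.assoc, c2.eq, c3.assoc,
    cX.assoc, d2.eq, d1.assoc, d2.assoc, d3.assoc, d4.assoc, dX.assoc, t1, t3, t4, t5, t7, t9,
    assoc t1, assoc t2, assoc t3, assoc t4, assoc t5, assoc t6, assoc t7]
  match_scalars <;> field_simp
  all_goals try ring1
  all_goals
    -- The remaining coefficients agree only for the actual value h = q / (q² - 1).
    rw [hh']
    field_simp
    ring

end GlRep

/-! ### The generators of the quantum `𝔤𝔩` superalgebra -/

theorem QComm.inv_left {A : Type*} [Ring A] [Algebra ℂ A] {c : ℂ} {a b x : A} (hc : c ≠ 0)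
    (hab : a * b = 1) (hba : b * a = 1) (h : QComm c a x) : QComm c⁻¹ b x := by
  have : b * (a * x) * b = c • (b * x) := by
    rw [h.eq, mul_smul_comm, smul_mul_assoc, mul_assoc, mul_assoc, hab, mul_one]
  rw [← mul_assoc, hba, one_mul] at this
  rw [QComm, this, smul_smul, inv_mul_cancel₀ hc, one_smul]

theorem HomElt.map_sbr {A B : Type*} [Ring A] [Algebra ℂ A] [Ring B] [Algebra ℂ B] (f : A →ₐ[ℂ] B)
    (u : ℂ) (x y : HomElt A) : (sbr u x y).map f = sbr u (x.map f) (y.map f) := by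
  simp [sbr, HomElt.map]

theorem neg_one_pow_val_mul (P Q : Prop) [Decidable P] [Decidable Q] :
    (-1 : ℂ) ^ ((if P then (1 : ZMod 2) else 0).val * (if Q then (1 : ZMod 2) else 0).val) =
      if P ∧ Q then -1 else 1 := by
  split_ifs <;> simp_all [ZMod.val_one]

section Gl

variable {q : ℂ} {M N : ℕ}

theorem mk_eq_of_rel {x y : FreeAlgebra ℂ (GlGen M N)} (h : GlRel q M N x y) :
    RingQuot.mkAlgHom ℂ (GlRel q M N) x = RingQuot.mkAlgHom ℂ (GlRel q M N) y :=
  RingQuot.mkAlgHom_rel ℂ h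

theorem t_eq_zero {ε : ℤˣ} {i : ℕ} (h : ¬(1 ≤ i ∧ i ≤ M + N)) : t q M N ε i = 0 := by
  rw [t, freeT, dif_neg h, map_zero]

theorem e_eq_zero {ε : ℤˣ} {j : ℕ} (h : ¬(1 ≤ j ∧ j < M + N)) : (e q M N ε j).val = 0 := by
  rw [e, freee, dif_neg h, HomElt.map, map_zero]

theorem e_deg (ε : ℤˣ) (j : ℕ) : (e q M N ε j).deg = if j = M then 1 else 0 := rfl

theorem t_mul_t_neg (ε : ℤˣ) {i : ℕ} (hi : 1 ≤ i ∧ i ≤ M + N) :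
    t q M N ε i * t q M N (-ε) i = 1 := by
  rw [t, t, ← map_mul, mk_eq_of_rel (GlRel.t_inv ε i hi), map_one]

theorem QComm.t_left {c : ℂ} {i : ℕ} {x : UGl q M N} (hc : c ≠ 0) (hi : 1 ≤ i ∧ i ≤ M + N)
    (h : QComm c (t q M N 1 i) x) (δ : ℤˣ) : QComm (c ^ (δ : ℤ)) (t q M N δ i) x := by
  rcases Int.units_eq_one_or δ with rfl | rfl
  · simpa using h
  · have h2 := t_mul_t_neg (q := q) (-1) hi
    rw [neg_neg] at h2
    simpa using h.inv_left hc (t_mul_t_neg 1 hi) h2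

theorem t_comm_t (ε δ : ℤˣ) (i j : ℕ) :
    t q M N ε i * t q M N δ j = t q M N δ j * t q M N ε i := by
  by_cases hi : 1 ≤ i ∧ i ≤ M + N
  · by_cases hj : 1 ≤ j ∧ j ≤ M + N
    · have h1 : QComm 1 (t q M N 1 i) (t q M N 1 j) := by
        apply QComm.of_commute
        rw [t, t, ← map_mul, ← map_mul, mk_eq_of_rel (GlRel.t_comm i j hi hj)]
      have h2 := ((h1.t_left one_ne_zero hi ε).congr (one_zpow _)).commute
      exact (((QComm.of_commute h2.symm).t_left one_ne_zero hj δ).congr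
        (one_zpow _)).commute.symm
    · rw [t_eq_zero hj, mul_zero, zero_mul]
  · rw [t_eq_zero hi, mul_zero, zero_mul]

theorem t_qComm_e (hq0 : q ≠ 0) (δ ε : ℤˣ) (i j : ℕ) :
    QComm (q ^ ((δ : ℤ) * (ε : ℤ) * (ind i j - ind i (j + 1)))) (t q M N δ i)
      (e q M N ε j).val := by
  by_cases hi : 1 ≤ i ∧ i ≤ M + N
  · by_cases hj : 1 ≤ j ∧ j < M + N
    · have h := mk_eq_of_rel (q := q) (GlRel.t_e ε i j hi hj)
      rw [map_mul, map_mul, map_smul] at h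
      change t q M N 1 i * (e q M N ε j).val * t q M N (-1) i = _ • (e q M N ε j).val at h
      have h2 := t_mul_t_neg (q := q) (-1) hi
      rw [neg_neg] at h2
      have h3 : QComm (q ^ ((ε : ℤ) * (ind i j - ind i (j + 1)))) (t q M N 1 i)
          (e q M N ε j).val := by
        have := congrArg (· * t q M N 1 i) h
        simp only [mul_assoc, h2, mul_one, smul_mul_assoc] at this
        rw [QComm, this]
        congr 3
        simp only [epsForm, ind, l_coe]
        split_ifs <;> omega
      refine (h3.t_left (zpow_ne_zero _ hq0) hi δ).congr ?_
      rw [← zpow_mul]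
      congr 1
      ring
    · rw [e_eq_zero hj, QComm, mul_zero, zero_mul, smul_zero]
  · rw [t_eq_zero hi, QComm, mul_zero, zero_mul, smul_zero]

theorem sbr_e_e (u : ℂ) (ε δ : ℤˣ) (j k : ℕ) :
    (sbr u (e q M N ε j) (e q M N δ k)).val =
      br ((if j = M ∧ k = M then -1 else 1) * u) (e q M N ε j).val (e q M N δ k).val := by
  rw [← neg_one_pow_val_mul]
  rfl

theorem sbr_e_eq {u : ℂ} {ε δ : ℤˣ} {j k : ℕ} {y : FreeAlgebra ℂ (GlGen M N)}
    (h : GlRel q M N (sbr u (freee M N ε j) (freee M N δ k)).val y) :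
    (sbr u (e q M N ε j) (e q M N δ k)).val = RingQuot.mkAlgHom ℂ (GlRel q M N) y := by
  rw [← mk_eq_of_rel h, e, e, ← HomElt.map_sbr]
  rfl

theorem e_cross_e (ε : ℤˣ) {j k : ℕ} (hjk : j ≠ k) :
    (e q M N ε j).val * (e q M N (-ε) k).val = (e q M N (-ε) k).val * (e q M N ε j).val := by
  by_cases hj : 1 ≤ j ∧ j < M + N
  · by_cases hk : 1 ≤ k ∧ k < M + N
    · have h : ∀ j k, 1 ≤ j ∧ j < M + N → 1 ≤ k ∧ k < M + N → j ≠ k →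
          (e q M N 1 j).val * (e q M N (-1) k).val =
            (e q M N (-1) k).val * (e q M N 1 j).val := by
        intro j k hj hk hjk
        have h := sbr_e_eq (q := q) (GlRel.e_cross j k hj hk hjk)
        rw [sbr_e_e, if_neg (by omega), map_zero, br_eq_zero_iff] at h
        exact (h.congr (mul_one 1)).commute
      rcases Int.units_eq_one_or ε with rfl | rfl
      · exact h j k hj hk hjk
      · rw [neg_neg]; exact (h k j hk hj hjk.symm).symm
    · rw [e_eq_zero hk, mul_zero, zero_mul]
  · rw [e_eq_zero hj, mul_zero, zero_mul]

theorem e_cross_same (ε : ℤˣ) (j : ℕ) :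
    br (sg M j) (e q M N ε j).val (e q M N (-ε) j).val =
      ((if ε = 1 then 1 else sg M j) * (qi q M j - (qi q M j)⁻¹)⁻¹) •
        (t q M N (ε * l M j) j * t q M N (-(ε * l M (j + 1))) (j + 1) -
          t q M N (-ε * l M j) j * t q M N (-(-ε * l M (j + 1))) (j + 1)) := by
  by_cases hj : 1 ≤ j ∧ j < M + N
  · have h := sbr_e_eq (q := q) (GlRel.e_cross_same j hj)
    rw [sbr_e_e, map_smul, map_sub, map_mul, map_mul] at h
    change _ = _ • (t q M N (l M j) j * t q M N (-l M (j + 1)) (j + 1) -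
      t q M N (-l M j) j * t q M N (l M (j + 1)) (j + 1)) at h
    simp only [and_self, mul_one] at h
    change br (sg M j) _ _ = _ at h
    rcases Int.units_eq_one_or ε with rfl | rfl
    · simpa using h
    · have e1 : br (sg M j) (e q M N (-1) j).val (e q M N 1 j).val =
          (-sg M j) • br (sg M j) (e q M N 1 j).val (e q M N (-1) j).val := by
        simp only [br, smul_sub, smul_smul, neg_mul, sg_mul_self]
        module
      rw [neg_neg, e1, h, if_neg (by decide)]
      simp only [neg_mul, one_mul, neg_neg]
      module
  · rw [e_eq_zero hj, br, zero_mul, mul_zero, smul_zero, sub_zero]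
    -- Outside the range the generators are 0; besides e_j, one of t_j and t_{j+1} vanishes, so the
    -- relation still holds.
    by_cases h : 1 ≤ j ∧ j ≤ M + N
    · rw [t_eq_zero (i := j + 1) (by omega), t_eq_zero (i := j + 1) (by omega)]
      simp
    · rw [t_eq_zero h, t_eq_zero h]
      simp

theorem cartan_eq (M j k : ℕ) : cartan M j k = kWeight M j k (k + 1) := by
  simp only [cartan, kWeight, epsForm, ind]
  split_ifs <;> ring

theorem e_comm_e (ε : ℤˣ) {j k : ℕ} (hjk : j + 1 < k) :
    (e q M N ε j).val * (e q M N ε k).val = (e q M N ε k).val * (e q M N ε j).val := by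
  by_cases hj : 1 ≤ j ∧ j < M + N
  · by_cases hk : 1 ≤ k ∧ k < M + N
    · have h := sbr_e_eq (q := q) (GlRel.e_comm ε j k hj hk (by
        simp only [cartan_eq, kWeight, ind, l_coe]
        split_ifs <;> omega))
      rw [sbr_e_e, if_neg (by omega), map_zero, br_eq_zero_iff] at h
      exact (h.congr (mul_one 1)).commute
    · rw [e_eq_zero hk, mul_zero, zero_mul]
  · rw [e_eq_zero hj, mul_zero, zero_mul]

theorem e_odd_sq (hM : 1 < M) (hN : 1 ≤ N) (ε : ℤˣ) :
    (e q M N ε M).val * (e q M N ε M).val = 0 := by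
  have hj : 1 ≤ M ∧ M < M + N := by omega
  have h := sbr_e_eq (q := q) (GlRel.e_comm ε M M hj hj (by
    simp only [cartan_eq, kWeight, ind, l_coe]
    split_ifs <;> omega))
  rw [sbr_e_e, if_pos ⟨rfl, rfl⟩, map_zero, br] at h
  have h2 : (2 : ℂ) • ((e q M N ε M).val * (e q M N ε M).val) = 0 := by
    rw [← h]; module
  exact (smul_eq_zero.1 h2).resolve_left two_ne_zero

theorem sbr_even (u : ℂ) {A : Type*} [Ring A] [Algebra ℂ A] (x y : HomElt A) (h : x.deg = 0) :
    (sbr u x y).val = br u x.val y.val := by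
  rw [sbr, h, br]
  simp

theorem e_serre (hq0 : q ≠ 0) (ε : ℤˣ) {j k : ℕ} (hjM : j ≠ M) (hjk : k = j + 1 ∨ j = k + 1) :
    Serre q (e q M N ε j).val (e q M N ε k).val := by
  by_cases hj : 1 ≤ j ∧ j < M + N
  · by_cases hk : 1 ≤ k ∧ k < M + N
    · have h := mk_eq_of_rel (GlRel.serre (q := q) ε j k hj hk (by
        simp only [cartan_eq, kWeight, ind, l_coe]
        split_ifs <;> omega) hjM)
      change ((sbr q (freee M N ε j) (sbr q⁻¹ (freee M N ε j) (freee M N ε k))).map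
        (RingQuot.mkAlgHom ℂ (GlRel q M N))).val = _ at h
      rw [HomElt.map_sbr, HomElt.map_sbr] at h
      change (sbr q (e q M N ε j) (sbr q⁻¹ (e q M N ε j) (e q M N ε k))).val = _ at h
      rw [sbr_even _ _ _ (if_neg hjM), sbr_even _ _ _ (if_neg hjM), map_zero,
        br_br_self hq0] at h
      exact h
    · rw [Serre, e_eq_zero hk]; simp
  · rw [Serre, e_eq_zero hj]; simp

theorem e_quartic (hM : 1 < M) (ε : ℤˣ) :
    QComm (-1) (e q M N ε M).val (br q⁻¹ (br q (e q M N ε (M - 1)).val (e q M N ε M).val)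
      (e q M N ε (M + 1)).val) := by
  by_cases hN : 1 < N
  · have h := mk_eq_of_rel (GlRel.quartic (q := q) ε hM hN)
    change ((sbr 1 (sbr q⁻¹ (sbr q (freee M N ε (M - 1)) (freee M N ε M))
          (freee M N ε (M + 1))) (freee M N ε M)).map
      (RingQuot.mkAlgHom ℂ (GlRel q M N))).val = _ at h
    rw [HomElt.map_sbr, HomElt.map_sbr, HomElt.map_sbr, map_zero] at h
    change (sbr 1 (sbr q⁻¹ (sbr q (e q M N ε (M - 1)) (e q M N ε M))
          (e q M N ε (M + 1))) (e q M N ε M)).val = _ at h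
    have h' : QComm (-1) (br q⁻¹ (br q (e q M N ε (M - 1)).val (e q M N ε M).val)
      (e q M N ε (M + 1)).val) (e q M N ε M).val := by
      rw [← br_eq_zero_iff, ← h]
      simp [sbr, br, e_deg, show ¬ M - 1 = M by omega, ZMod.val_one]
    exact (h'.symm (by norm_num)).congr (by norm_num)
  -- For N = 1 the default value e_{M+1} = 0 makes the quartic relation trivial.
  · rw [e_eq_zero (j := M + 1) (by omega)]
    simp [QComm, br]

variable (q M N) in
/-- The generators of `U_q(𝔤𝔩(M, N))` satisfy its relations. -/
def glRep (hq0 : q ≠ 0) (hq : ∀ n : ℕ, 0 < n → q ^ n ≠ 1) (hM : 1 < M) (hN : 1 ≤ N) :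
    GlRep q M (M + N) (UGl q M N) where
  t := t q M N
  e ε j := (e q M N ε j).val
  q_ne := hq0
  sq_ne_one := hq 2 (by norm_num)
  -- From q⁴ - 1 = (q² - 1)(q² + 1).
  sq_add_one_ne h := hq 4 (by norm_num) (by linear_combination (q ^ 2 - 1) * h)
  one_lt := hM
  lt := by omega
  t_inv ε i h1 h2 := t_mul_t_neg ε ⟨h1, h2⟩
  t_comm := t_comm_t
  t_e := t_qComm_e hq0
  cross ε _ _ h := e_cross_e ε h
  cross_same := e_cross_same
  comm ε _ _ h := e_comm_e ε h
  sq := e_odd_sq hM hN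
  serre ε _ _ h1 h2 := e_serre hq0 ε h1 h2
  quartic := e_quartic hM

theorem eBracket_deg (hM : 1 < M) (ε : ℤˣ) (k : ℕ) :
    (eBracket q M N ε k).deg = if M ≤ k + 1 then 1 else 0 := by
  induction k with
  | zero => rw [eBracket, e_deg, if_neg (by omega), if_neg (by omega)]
  | succ k ih =>
    change (eBracket q M N ε k).deg + (e q M N ε (k + 2)).deg = _
    rw [ih, e_deg]
    split_ifs <;> first | omega | rfl

/-- No super sign ever occurs: the only odd generator e_M is bracketed with an even element, since
the nodes before it are all even. -/
theorem eBracket_val (hq0 : q ≠ 0) (hq : ∀ n : ℕ, 0 < n → q ^ n ≠ 1) (hM : 1 < M) (hN : 1 ≤ N)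
    (ε : ℤˣ) (k : ℕ) :
    (eBracket q M N ε k).val = (glRep q M N hq0 hq hM hN).seg ε 1 k := by
  induction k with
  | zero => rfl
  | succ k ih =>
    rw [GlRep.seg_succ (b := k + 2) _ (by omega), ← ih, eBracket, sbr, eBracket_deg hM, e_deg,
      neg_one_pow_val_mul, if_neg (show ¬(M ≤ k + 1 ∧ k + 2 = M) by omega), one_mul]
    rfl

end Gl

/-! ### Verification of the affine relations -/

section Evaluation

variable {A : Type*} [Ring A] [Algebra ℂ A]

theorem br_smul_left (c a : ℂ) (x y : A) : br c (a • x) y = a • br c x y := by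
  simp only [br, smul_mul_assoc, mul_smul_comm, smul_sub]
  module

theorem br_smul_right (c a : ℂ) (x y : A) : br c x (a • y) = a • br c x y := by
  simp only [br, smul_mul_assoc, mul_smul_comm, smul_sub]
  module

namespace GlRep

variable {q : ℂ} {M n : ℕ} (D : GlRep q M n A)

/-- The image of `E_0^ε`. -/
def affE (ε : ℤˣ) : A :=
  if ε = 1 then (-(-q) ^ ((n : ℤ) - M - M)) • (D.seg (-1) 1 (n - 2) * D.t 1 1 * D.t (-1) n)
  else D.t (-1) 1 * D.t 1 n * D.seg 1 1 (n - 2)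

theorem affE_one :
    D.affE 1 = (-(-q) ^ ((n : ℤ) - M - M)) • (D.seg (-1) 1 (n - 2) * D.T 1) := by
  rw [affE, if_pos rfl, mul_assoc, T]

theorem affE_neg_one : D.affE (-1) = D.T (-1) * D.seg 1 1 (n - 2) := by
  rw [affE, if_neg (by decide), T, neg_neg]

/-- The value of c is irrelevant to every relation except the bracket of E_0^+ with E_0^-. -/
theorem exists_affE_eq (ε : ℤˣ) : ∃ c : ℂ, D.affE ε = c • D.z ε := by
  rcases Int.units_eq_one_or ε with rfl | rfl
  · exact ⟨_, D.affE_one⟩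
  · have h : QComm _ _ _ := D.T_top (ε := -1)
    rw [neg_neg] at h
    refine ⟨q ^ (-2 : ℤ), ?_⟩
    rw [affE_neg_one, h.eq, z, neg_neg]

/-- The image of `E_i^ε`. -/
def evE (ε : ℤˣ) (i : ℕ) : A := if i = 0 then D.affE ε else D.e ε i

/-- The image of `K_i^δ`. -/
def evK (δ : ℤˣ) (i : ℕ) : A := if i = 0 then D.t (-δ) 1 * D.t (-δ) n else D.K δ i

theorem evK_mul_evK_neg (δ : ℤˣ) {i : ℕ} (hi : i < n) : D.evK δ i * D.evK (-δ) i = 1 := by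
  unfold evK
  split_ifs with h
  · have e1 := D.t_inv (-δ) 1 le_rfl (by omega)
    have e2 := D.t_inv (-δ) n (by omega) le_rfl
    rw [mul_assoc, ← mul_assoc (D.t _ n), D.t_comm _ _ n 1, mul_assoc, e2, mul_one, e1]
  · exact D.K_inv δ (by omega) hi

theorem evK_comm (δ ε : ℤˣ) (i j : ℕ) : D.evK δ i * D.evK ε j = D.evK ε j * D.evK δ i := by
  have h : ∀ ε δ i j, Commute (D.t ε i) (D.t δ j) := D.t_comm
  unfold evK K
  split_ifs <;>
  exact ((h _ _ _ _).mul_right (h _ _ _ _)).mul_left ((h _ _ _ _).mul_right (h _ _ _ _))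

theorem evK_qComm_T (i : ℕ) (ε : ℤˣ) : QComm 1 (D.evK 1 i) (D.T ε) := by
  have h : ∀ ε δ i j, Commute (D.t ε i) (D.t δ j) := D.t_comm
  apply QComm.of_commute
  unfold evK K T
  split_ifs <;>
  exact ((h _ _ _ _).mul_right (h _ _ _ _)).mul_left ((h _ _ _ _).mul_right (h _ _ _ _))

theorem evK_qComm_evE (N : ℕ) (hN : n = M + N) (ε : ℤˣ) {i j : ℕ} (hi : i < n) (hj : j < n) :
    QComm (q ^ ((ε : ℤ) * affCartan M N i j)) (D.evK 1 i) (D.evE ε j) := by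
  subst hN
  have hM := D.one_lt
  have hn := D.lt
  by_cases h0 : j = 0
  · obtain ⟨c, hc⟩ := D.exists_affE_eq ε
    rw [evE, if_pos h0, hc, affCartan, if_pos h0]
    refine QComm.smul_right _ (((?_ : QComm _ _ _).mul_right (D.evK_qComm_T i ε)).congr
      (mul_one _))
    unfold evK
    split_ifs with hi0
    · refine D.t_t_seg _ _ _ _ _ _ _ _ ?_
      rw [Units.val_neg ε, neg_mul, ← mul_neg]
      congr 1
      simp only [ind, Units.val_neg, Units.val_one]
      split_ifs <;> omega
    · subst h0
      refine D.K_seg _ _ _ _ _ _ ?_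
      rw [Units.val_one, one_mul, Units.val_neg, neg_mul, ← mul_neg]
      congr 1
      simp only [kWeight, ind, l_coe, cartanZero]
      split_ifs <;> omega
  · rw [evE, if_neg h0, affCartan, if_neg h0]
    unfold evK
    split_ifs with hi0
    · refine D.t_t_seg _ _ _ _ _ _ 0 _ ?_
      congr 1
      simp only [ind, Units.val_neg, Units.val_one, cartanZero]
      split_ifs <;> omega
    · refine D.K_seg _ _ _ _ 0 _ ?_
      rw [cartan_eq]
      simp

/-- The exponent rises by one for each node up to M and falls by one for each node after it. -/
theorem prod_neg_qi (D : GlRep q M n A) (k : ℕ) :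
    ∏ j ∈ Finset.range k, -qi q M (j + 2) =
      (-q) ^ (if k + 1 < M then (k : ℤ) else 2 * (M - 1) - k) := by
  have hM := D.one_lt
  have hq : -q ≠ 0 := neg_ne_zero.2 D.q_ne
  induction k with
  | zero => rw [if_pos (by omega)]; simp
  | succ k ih =>
    have : -qi q M (k + 2) = (-q) ^ (if k + 2 ≤ M then (1 : ℤ) else -1) := by
      rw [qi, l_coe]
      split_ifs
      · simp
      · rw [zpow_neg_one, zpow_neg_one, inv_neg]
    rw [Finset.prod_range_succ, ih, this, ← zpow_add₀ hq]
    congr 1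
    split_ifs <;> push_cast <;> omega

/-- The opposite torus factors cancel, leaving the bracket of the two longest root vectors; the sign
and the power of -q in the image of E_0^+ then absorb the scalar found there. -/
theorem affE_cross_same :
    br (-1) (D.affE 1) (D.affE (-1)) = (q - q⁻¹)⁻¹ • (D.evK 1 0 - D.evK (-1) 0) := by
  have hM := D.one_lt
  have hn := D.lt
  have hq : -q ≠ 0 := neg_ne_zero.2 D.q_ne
  have h := D.br_seg_seg (n - 2) (by omega)
  rw [if_pos (by omega), D.prod_neg_qi, if_neg (show ¬n - 2 + 1 < M by omega), show n - 2 + 2 = n by omega,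
    show l M n = -1 from if_neg (by omega), neg_neg] at h
  have hX : QComm _ _ _ := D.T_top (ε := 1)
  have hY : QComm (q ^ (2 : ℤ)) (D.T 1) (D.seg 1 1 (n - 2)) := by
    apply D.T_seg
    simp only [topWeight, ind, Units.val_one]
    split_ifs <;> omega
  have hYX := (hY.mul_right hX).congr (d := 1) (by rw [← zpow_add₀ D.q_ne]; exact zpow_zero q)
  have i1 : D.T 1 * D.T (-1) = 1 := D.T_inv 1
  have i2 : D.T (-1) * D.T 1 = 1 := by simpa using D.T_inv (-1)
  have e1 : br (-1) (D.seg (-1) 1 (n - 2) * D.T 1) (D.T (-1) * D.seg 1 1 (n - 2)) =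
      br (-1) (D.seg 1 1 (n - 2)) (D.seg (-1) 1 (n - 2)) := by
    have a1 : D.seg (-1) 1 (n - 2) * D.T 1 * (D.T (-1) * D.seg 1 1 (n - 2)) =
        D.seg (-1) 1 (n - 2) * D.seg 1 1 (n - 2) := by
      rw [mul_assoc, ← mul_assoc (D.T 1), i1, one_mul]
    have a2 : D.T (-1) * D.seg 1 1 (n - 2) * (D.seg (-1) 1 (n - 2) * D.T 1) =
        D.seg 1 1 (n - 2) * D.seg (-1) 1 (n - 2) := by
      rw [mul_assoc, ← mul_assoc (D.seg 1 1 (n - 2)), ← hYX.commute, ← mul_assoc, i2, one_mul]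
    rw [br, br, a1, a2]
    module
  rw [affE_one, affE_neg_one, br_smul_left, e1, h, smul_smul, ← mul_assoc, neg_mul,
    ← zpow_add₀ hq, show (n : ℤ) - M - M + (2 * (M - 1) - ((n - 2 : ℕ) : ℤ)) = 0 by omega, zpow_zero,
    evK, evK, if_pos rfl, if_pos rfl, neg_neg]
  module

theorem evE_qComm_evE_neg (ε : ℤˣ) {i j : ℕ} (hi : i < n) (hj : j < n) (hij : i ≠ j) :
    QComm (if (i = 0 ∨ i = M) ∧ (j = 0 ∨ j = M) then -1 else 1) (D.evE ε i) (D.evE (-ε) j) := by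
  have hM := D.one_lt
  rcases Nat.eq_zero_or_pos i with rfl | hi0
  · obtain ⟨c, hc⟩ := D.exists_affE_eq ε
    rw [evE, evE, if_pos rfl, if_neg hij.symm, hc]
    refine ((D.z_cross (by omega) hj).smul_left _).congr ?_
    unfold sg
    split_ifs <;> first | omega | rfl
  · rcases Nat.eq_zero_or_pos j with rfl | hj0
    · obtain ⟨c, hc⟩ := D.exists_affE_eq (-ε)
      have h := D.z_cross (ε := -ε) hi0 hi
      rw [neg_neg] at h
      rw [evE, evE, if_pos rfl, if_neg hij, hc]
      refine ((QComm_sg_symm h).smul_right _).congr ?_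
      unfold sg
      split_ifs <;> first | omega | rfl
    · rw [evE, evE, if_neg (by omega), if_neg (by omega), if_neg (by omega)]
      exact QComm.of_commute (D.cross _ _ _ hij)

theorem evE_qComm_evE (N : ℕ) (hN : n = M + N) (ε : ℤˣ) {i j : ℕ} (hi : i < n) (hj : j < n)
    (hc : affCartan M N i j = 0) :
    QComm (if (i = 0 ∨ i = M) ∧ (j = 0 ∨ j = M) then -1 else 1) (D.evE ε i) (D.evE ε j) := by
  have hM := D.one_lt
  have hlt := D.lt
  obtain ⟨c, hz⟩ := D.exists_affE_eq ε
  have inner : ∀ j, j ≠ 0 → j < n → cartanZero M N j = 0 → 1 < j ∧ j + 1 < n := by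
    intro j h0 h1 h2
    unfold cartanZero at h2
    split_ifs at h2 <;> omega
  rcases eq_or_ne i 0 with rfl | hi0
  · rcases eq_or_ne j 0 with rfl | hj0
    · rw [evE, if_pos rfl, hz, QComm, smul_mul_smul_comm, D.z_sq, smul_zero, smul_zero]
    · rw [affCartan, if_pos rfl, if_neg hj0] at hc
      obtain ⟨h1, h2⟩ := inner j hj0 hj hc
      rw [evE, evE, if_pos rfl, if_neg hj0, hz]
      refine ((D.z_qComm_e h1 h2).smul_left _).congr ?_
      unfold sg
      split_ifs <;> first | omega | rfl
  · rcases eq_or_ne j 0 with rfl | hj0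
    · rw [affCartan, if_neg hi0, if_pos rfl] at hc
      obtain ⟨h1, h2⟩ := inner i hi0 hi hc
      rw [evE, evE, if_pos rfl, if_neg hi0, hz]
      refine ((QComm_sg_symm (D.z_qComm_e h1 h2)).smul_right _).congr ?_
      unfold sg
      split_ifs <;> first | omega | rfl
    · rw [affCartan, if_neg hi0, if_neg hj0, cartan_eq] at hc
      -- The only vanishing diagonal entry of the finite Cartan matrix is at M, and adjacent nodes
      -- have entry ±1.
      have : (i = M ∧ j = M) ∨ i + 1 < j ∨ j + 1 < i := by
        simp only [kWeight, ind, l_coe] at hc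
        split_ifs at hc <;> omega
      rw [evE, evE, if_neg hi0, if_neg hj0]
      rcases this with ⟨rfl, rfl⟩ | h | h
      · rw [QComm, D.sq, smul_zero]
      · rw [if_neg (by omega)]
        exact QComm.of_commute (D.comm _ _ _ h)
      · rw [if_neg (by omega)]
        exact QComm.of_commute (D.comm _ _ _ h).symm

theorem serre_evE (N : ℕ) (hN : n = M + N) (ε : ℤˣ) {i j : ℕ} (hi : i < n)
    (hc : affCartan M N i j = 1 ∨ affCartan M N i j = -1) (hi0 : i ≠ 0) (hiM : i ≠ M) :
    Serre q (D.evE ε i) (D.evE ε j) := by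
  have hM := D.one_lt
  have hlt := D.lt
  rw [affCartan, if_neg hi0] at hc
  rw [evE, evE, if_neg hi0]
  split_ifs at hc ⊢ with hj0
  · obtain ⟨c, hz⟩ := D.exists_affE_eq ε
    have h := D.serre_z (ε := ε) (j := i) (by
      unfold cartanZero at hc
      split_ifs at hc <;> omega) hiM
    rw [hz, Serre]
    rw [Serre] at h
    simp only [smul_mul_assoc, mul_smul_comm, smul_comm _ c, ← smul_sub, ← smul_add, h, smul_zero]
  · apply D.serre _ _ _ hiM
    rw [cartan_eq] at hc
    simp only [kWeight, ind, l_coe] at hc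
    split_ifs at hc <;> omega

end GlRep

theorem sbr_ite_ite (u : ℂ) (P Q : Prop) [Decidable P] [Decidable Q] (x y : A) :
    (sbr u ⟨if P then 1 else 0, x⟩ ⟨if Q then 1 else 0, y⟩).val =
      br ((if P ∧ Q then -1 else 1) * u) x y := by
  rw [← neg_one_pow_val_mul]
  rfl

theorem sbr_zero_left (u : ℂ) (d : ZMod 2) (x y : A) :
    sbr u ⟨0, x⟩ ⟨d, y⟩ = ⟨d, br u x y⟩ := by
  simp [sbr, br]

theorem sbr_zero_right (u : ℂ) (d : ZMod 2) (x y : A) :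
    sbr u ⟨d, x⟩ ⟨0, y⟩ = ⟨d, br u x y⟩ := by
  simp [sbr, br]

theorem sbr_one_one (u : ℂ) (x y : A) : sbr u ⟨1, x⟩ ⟨1, y⟩ = ⟨0, br (-u) x y⟩ := by
  simp [sbr, br, ZMod.val_one, CharTwo.add_self_eq_zero]

variable {q : ℂ} {M N : ℕ}

/-- The evaluation morphism on the free algebra. -/
def freeEv (D : GlRep q M (M + N) A) : FreeAlgebra ℂ (AffGen M N) →ₐ[ℂ] A :=
  FreeAlgebra.lift ℂ fun
    | .K ε i _ => D.evK ε i
    | .E ε i _ => D.evE ε i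

theorem freeEv_freeK (D : GlRep q M (M + N) A) (ε : ℤˣ) {i : ℕ} (hi : i < M + N) :
    freeEv D (freeK M N ε i) = D.evK ε i := by
  rw [freeK, dif_pos hi, freeEv, FreeAlgebra.lift_ι_apply]

theorem map_freeEv_freeE (D : GlRep q M (M + N) A) (ε : ℤˣ) {i : ℕ} (hi : i < M + N) :
    (freeE M N ε i).map (freeEv D) = ⟨if i = 0 ∨ i = M then 1 else 0, D.evE ε i⟩ := by
  rw [freeE, HomElt.map, dif_pos hi, freeEv, FreeAlgebra.lift_ι_apply]

theorem freeEv_freeE (D : GlRep q M (M + N) A) (ε : ℤˣ) {i : ℕ} (hi : i < M + N) :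
    freeEv D (freeE M N ε i).val = D.evE ε i :=
  congrArg HomElt.val (map_freeEv_freeE D ε hi)

theorem freeEv_sbr (D : GlRep q M (M + N) A) (u : ℂ) (x y : HomElt (FreeAlgebra ℂ (AffGen M N))) :
    freeEv D (sbr u x y).val = (sbr u (x.map (freeEv D)) (y.map (freeEv D))).val := by
  rw [← HomElt.map_sbr]; rfl

theorem freeEv_rel (D : GlRep q M (M + N) A) ⦃x y : FreeAlgebra ℂ (AffGen M N)⦄
    (h : AffRel q M N x y) : freeEv D x = freeEv D y := by
  have hM := D.one_lt
  have hlt := D.lt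
  cases h with
  | K_inv ε i hi =>
    rw [map_mul, map_one, freeEv_freeK D _ hi, freeEv_freeK D _ hi, D.evK_mul_evK_neg ε hi]
  | K_comm i j hi hj =>
    rw [map_mul, map_mul, freeEv_freeK D _ hi, freeEv_freeK D _ hj, D.evK_comm]
  | K_E ε i j hi hj =>
    have h : QComm _ _ _ := D.evK_qComm_evE N rfl ε hi hj
    rw [map_mul, map_mul, map_smul, freeEv_freeK D _ hi, freeEv_freeK D _ hi, freeEv_freeE D _ hj,
      h.eq, smul_mul_assoc, mul_assoc, D.evK_mul_evK_neg 1 hi, mul_one]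
  | E_cross_same i hi =>
    rw [freeEv_sbr, map_freeEv_freeE D _ hi, map_freeEv_freeE D _ hi, sbr_ite_ite, map_smul, map_sub,
      freeEv_freeK D _ hi, freeEv_freeK D _ hi, mul_one]
    rcases eq_or_ne i 0 with rfl | h0
    · rw [if_pos (by simp), GlRep.qi_of_le (by omega)]
      exact D.affE_cross_same
    · have h := D.cross_K (ε := 1) (j := i)
      rw [if_pos rfl, one_mul] at h
      simpa [GlRep.evE, GlRep.evK, h0, sg] using h
  | E_cross i j hi hj hij =>
    rw [freeEv_sbr, map_freeEv_freeE D _ hi, map_freeEv_freeE D _ hj, sbr_ite_ite, map_zero, mul_one,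
      br_eq_zero_iff]
    exact D.evE_qComm_evE_neg 1 hi hj hij
  | E_comm ε i j hi hj hc =>
    rw [freeEv_sbr, map_freeEv_freeE D _ hi, map_freeEv_freeE D _ hj, sbr_ite_ite, map_zero, mul_one,
      br_eq_zero_iff]
    exact D.evE_qComm_evE N rfl ε hi hj hc
  | serre ε i j hi hj hc h0 hiM =>
    rw [freeEv_sbr, HomElt.map_sbr, map_freeEv_freeE D _ hi, map_freeEv_freeE D _ hj,
      if_neg (by omega), sbr_zero_left, sbr_zero_left, map_zero]
    exact (br_br_self D.q_ne _ _).trans (D.serre_evE N rfl ε hi hc h0 hiM)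
  | quartic_M ε h3 =>
    rw [freeEv_sbr, HomElt.map_sbr, HomElt.map_sbr, map_freeEv_freeE D _ hlt,
      map_freeEv_freeE D _ (show M - 1 < M + N by omega),
      map_freeEv_freeE D _ (Nat.mod_lt (M + 1) (by omega)),
      if_neg (show ¬(M - 1 = 0 ∨ M - 1 = M) by omega), if_pos (Or.inr rfl), sbr_zero_left, map_zero]
    -- For N = 1 the node after M is the affine one, which is odd, so the signs differ.
    rcases eq_or_ne N 1 with rfl | hN
    · rw [Nat.mod_self, if_pos (Or.inl rfl), sbr_one_one, sbr_zero_left]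
      obtain ⟨c, hz⟩ := D.exists_affE_eq ε
      have h := D.quartic_M_affine ε rfl h3
      simp only [GlRep.evE, if_neg (show ¬ M - 1 = 0 by omega), if_neg (show ¬ M = 0 by omega), hz,
        if_pos, br_smul_right, br_smul_left, h, smul_zero]
    · rw [Nat.mod_eq_of_lt (by omega), if_neg (by omega), sbr_zero_right, sbr_one_one]
      have h := D.quartic_M ε
      simpa only [GlRep.evE, if_neg (show ¬ M - 1 = 0 by omega), if_neg (show ¬ M = 0 by omega),
        if_neg (show ¬ M + 1 = 0 by omega)] using h
  | quartic_zero ε h3 =>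
    rw [freeEv_sbr, HomElt.map_sbr, HomElt.map_sbr, map_freeEv_freeE D _ (show 0 < M + N by omega),
      map_freeEv_freeE D _ (show 1 < M + N by omega),
      map_freeEv_freeE D _ (show M + N - 1 < M + N by omega),
      if_neg (show ¬(1 = 0 ∨ 1 = M) by omega), if_pos (Or.inl rfl), sbr_zero_left, map_zero]
    obtain ⟨c, hz⟩ := D.exists_affE_eq ε
    have h := D.quartic_zero (ε := ε) h3
    rw [← br_eq_zero_iff] at h
    have hn : ¬ M + N - 1 = 0 := by omega
    rcases eq_or_ne N 1 with rfl | hN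
    · rw [if_pos (by omega), sbr_one_one, sbr_zero_left]
      rw [sg, if_pos (by omega), neg_neg, neg_one_mul] at h
      simp only [GlRep.evE, if_neg hn, if_neg one_ne_zero, hz, if_pos, br_smul_right, br_smul_left,
        h, smul_zero]
    · rw [if_neg (by omega), sbr_zero_right, sbr_one_one]
      rw [sg, if_neg (by omega), one_mul] at h
      simp only [GlRep.evE, if_neg hn, if_neg one_ne_zero, hz, if_pos, br_smul_right, br_smul_left,
        h, smul_zero]
  | quintic ε hM2 hN1 =>
    subst hM2 hN1
    -- E_0 occurs twice on each side, so both sides acquire the same factor c².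
    obtain ⟨c, hz⟩ := D.exists_affE_eq ε
    have h := D.quintic ε
    have e0 := map_freeEv_freeE D ε (i := 0) (by omega)
    have e1 := map_freeEv_freeE D ε (i := 1) (by omega)
    have e2 := map_freeEv_freeE D ε (i := 2) (by omega)
    rw [if_pos (by omega)] at e0 e2
    rw [if_neg (by omega)] at e1
    simp only [freeEv_sbr, HomElt.map_sbr, e0, e1, e2, sbr_zero_right, sbr_one_one,
      GlRep.evE, if_pos, if_neg one_ne_zero, if_neg two_ne_zero, hz, br_smul_right, br_smul_left, h]

end Evaluation

/-! ### Compatibility with parity -/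

section Grading

variable {q : ℂ} {M N : ℕ}

theorem sbr_mem_part {X : Type*} {p : X → ZMod 2} {r : FreeAlgebra ℂ X → FreeAlgebra ℂ X → Prop}
    (u : ℂ) {x y : HomElt (RingQuot r)} (hx : x.val ∈ part p r x.deg) (hy : y.val ∈ part p r y.deg) :
    (sbr u x y).val ∈ part p r (sbr u x y).deg := by
  refine Submodule.sub_mem _ (SetLike.mul_mem_graded hx hy) (Submodule.smul_mem _ _ ?_)
  have := SetLike.mul_mem_graded hy hx
  rwa [add_comm] at this

theorem mul_mem_part {X : Type*} {p : X → ZMod 2} {r : FreeAlgebra ℂ X → FreeAlgebra ℂ X → Prop}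
    {i j k : ZMod 2} {x y : RingQuot r} (hx : x ∈ part p r i) (hy : y ∈ part p r j)
    (h : i + j = k) : x * y ∈ part p r k :=
  h ▸ SetLike.mul_mem_graded hx hy

theorem map_freePart_mem {X Y : Type*} {p : X → ZMod 2} {p' : Y → ZMod 2}
    {r : FreeAlgebra ℂ X → FreeAlgebra ℂ X → Prop} (f : FreeAlgebra ℂ Y →ₐ[ℂ] RingQuot r)
    (hf : ∀ y, f (FreeAlgebra.ι ℂ y) ∈ part p r (p' y)) {i : ZMod 2} {a : FreeAlgebra ℂ Y}
    (ha : a ∈ freePart p' i) : f a ∈ part p r i := by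
  have h : freePart p' i ≤ (part p r i).comap f.toLinearMap := by
    refine Submodule.span_le.2 ?_
    rintro _ ⟨L, rfl, rfl⟩
    change f _ ∈ part p r _
    clear ha
    induction L with
    | nil => simpa using SetLike.GradedOne.one_mem (A := part p r)
    | cons y L ih =>
      simp only [List.map_cons, List.prod_cons, List.sum_cons, map_mul]
      exact SetLike.mul_mem_graded (hf y) ih
  exact h ha

theorem t_mem (ε : ℤˣ) (i : ℕ) : t q M N ε i ∈ glGrading q M N 0 :=
  mk_mem_part _ _ (freeT_mem M N ε i)

theorem e_mem (ε : ℤˣ) (j : ℕ) : (e q M N ε j).val ∈ glGrading q M N (e q M N ε j).deg :=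
  mk_mem_part _ _ (freee_homog M N ε j)

theorem eBracket_mem (ε : ℤˣ) (k : ℕ) :
    (eBracket q M N ε k).val ∈ glGrading q M N (eBracket q M N ε k).deg := by
  induction k with
  | zero => exact e_mem ε 1
  | succ k ih => exact sbr_mem_part _ ih (e_mem ε (k + 2))

theorem freeEv_ι_mem (hq0 : q ≠ 0) (hq : ∀ n : ℕ, 0 < n → q ^ n ≠ 1) (hM : 1 < M) (hN : 1 ≤ N)
    (y : AffGen M N) :
    freeEv (glRep q M N hq0 hq hM hN) (FreeAlgebra.ι ℂ y) ∈ glGrading q M N y.deg := by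
  have htt : ∀ ε δ i j, t q M N ε i * t q M N δ j ∈ glGrading q M N 0 := fun ε δ i j =>
    mul_mem_part (t_mem ε i) (t_mem δ j) (add_zero 0)
  rw [freeEv, FreeAlgebra.lift_ι_apply]
  rcases y with ⟨ε, i, hi⟩ | ⟨ε, i, hi⟩
  · change GlRep.evK _ _ _ ∈ glGrading q M N 0
    unfold GlRep.evK
    split_ifs
    · exact htt _ _ _ _
    · exact htt _ _ _ _
  · change GlRep.evE _ _ _ ∈ glGrading q M N (if i = 0 ∨ i = M then 1 else 0)
    unfold GlRep.evE
    by_cases h0 : i = 0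
    · rw [if_pos h0, if_pos (Or.inl h0)]
      have hB : ∀ ε, (glRep q M N hq0 hq hM hN).seg ε 1 (M + N - 2) ∈ glGrading q M N 1 := by
        intro ε
        have := eBracket_mem (q := q) (M := M) (N := N) ε (M + N - 2)
        rwa [eBracket_deg hM, if_pos (by omega), eBracket_val hq0 hq hM hN] at this
      unfold GlRep.affE
      split_ifs
      · refine Submodule.smul_mem _ _ ?_
        rw [mul_assoc]
        exact mul_mem_part (hB _) (htt _ _ _ _) (add_zero 1)
      · exact mul_mem_part (htt _ _ _ _) (hB _) (zero_add 1)
    · rw [if_neg h0]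
      simp only [h0, false_or]
      exact e_mem ε i

end Grading

/-! ### The evaluation morphism on the quotient -/

variable (q : ℂ) (M N : ℕ)

/-- The evaluation morphism. -/
def evHom (hq0 : q ≠ 0) (hq : ∀ n : ℕ, 0 < n → q ^ n ≠ 1) (hM : 1 < M) (hN : 1 ≤ N) :
    GradedAlgHom ℂ (affGrading q M N) (glGrading q M N) where
  toAlgHom := RingQuot.liftAlgHom ℂ ⟨freeEv (glRep q M N hq0 hq hM hN), freeEv_rel _⟩
  map_mem := by
    rintro i _ ⟨a, ha, rfl⟩
    change RingQuot.liftAlgHom ℂ _ (RingQuot.mkAlgHom ℂ _ a) ∈ _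
    rw [RingQuot.liftAlgHom_mkAlgHom_apply]
    exact map_freePart_mem _ (freeEv_ι_mem hq0 hq hM hN) ha

variable {q M N} in
theorem evHom_mk (hq0 : q ≠ 0) (hq : ∀ n : ℕ, 0 < n → q ^ n ≠ 1) (hM : 1 < M) (hN : 1 ≤ N)
    (x : FreeAlgebra ℂ (AffGen M N)) :
    evHom q M N hq0 hq hM hN (RingQuot.mkAlgHom ℂ (AffRel q M N) x) =
      freeEv (glRep q M N hq0 hq hM hN) x :=
  RingQuot.liftAlgHom_mkAlgHom_apply ℂ _ _ x

end QSuper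

end

theorem mainTheorem9 (q : ℂ) (hq0 : q ≠ 0) (hq : ∀ n : ℕ, 0 < n → q ^ n ≠ 1)
    (M N : ℕ) (hM : 1 < M) (hN : 1 ≤ N) (hMN : M ≠ N) :
    ∃ ev : GradedAlgHom ℂ (QSuper.affGrading q M N) (QSuper.glGrading q M N),
      (∀ j : ℕ, 1 ≤ j → j ≤ M + N - 1 →
        ev (QSuper.K q M N 1 j) =
            QSuper.t q M N (QSuper.l M j) j * QSuper.t q M N (-QSuper.l M (j + 1)) (j + 1) ∧
          ∀ ε : ℤˣ, ev (QSuper.E q M N ε j).val = (QSuper.e q M N ε j).val) ∧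
      ev (QSuper.K q M N 1 0) = QSuper.t q M N (-1) 1 * QSuper.t q M N (-1) (M + N) ∧
      ev (QSuper.E q M N 1 0).val =
        (-(-q) ^ ((N : ℤ) - (M : ℤ))) •
          ((QSuper.eBracket q M N (-1) (M + N - 2)).val *
            QSuper.t q M N 1 1 * QSuper.t q M N (-1) (M + N)) ∧
      ev (QSuper.E q M N (-1) 0).val =
        QSuper.t q M N (-1) 1 * QSuper.t q M N 1 (M + N) *
          (QSuper.eBracket q M N 1 (M + N - 2)).val := by
  have hK : ∀ i, i < M + N → QSuper.evHom q M N hq0 hq hM hN (QSuper.K q M N 1 i) =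
      (QSuper.glRep q M N hq0 hq hM hN).evK 1 i := fun i hi =>
    (QSuper.evHom_mk hq0 hq hM hN _).trans (QSuper.freeEv_freeK _ _ hi)
  have hE : ∀ ε i, i < M + N → QSuper.evHom q M N hq0 hq hM hN (QSuper.E q M N ε i).val =
      (QSuper.glRep q M N hq0 hq hM hN).evE ε i := fun ε i hi =>
    (QSuper.evHom_mk hq0 hq hM hN _).trans (QSuper.freeEv_freeE _ _ hi)
  refine ⟨QSuper.evHom q M N hq0 hq hM hN, fun j h1 h2 => ⟨?_, fun ε => ?_⟩, ?_, ?_, ?_⟩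
  · rw [hK j (by omega), QSuper.GlRep.evK, if_neg (by omega), QSuper.GlRep.K, one_mul, one_mul]
    rfl
  · rw [hE ε j (by omega), QSuper.GlRep.evE, if_neg (by omega)]
    rfl
  · rw [hK 0 (by omega), QSuper.GlRep.evK, if_pos rfl]
    rfl
  · rw [hE 1 0 (by omega), QSuper.GlRep.evE, if_pos rfl, QSuper.GlRep.affE, if_pos rfl,
      QSuper.eBracket_val hq0 hq hM hN,
      show ((M + N : ℕ) : ℤ) - M - M = (N : ℤ) - M by push_cast; ring]
    rfl
  · rw [hE (-1) 0 (by omega), QSuper.GlRep.evE, if_pos rfl, QSuper.GlRep.affE,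
      if_neg (by decide), QSuper.eBracket_val hq0 hq hM hN]
    rfl
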